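/- Let $N\ge 2$, $1<p\le N$ and $0<r_1<r_2<R$. Write $B_R=\{x\in\mathbb R^N:|x|<R\}$ and $S=\{x\in\mathbb R^N: r_1<|x|<r_2\}$. Let $W^{1,p}_0(B_R)$ be the closure of $C^\infty_0(B_R)$ in $W^{1,p}(B_R)$, and let \[ \mathrm{cap}_p(\overline{B_{r_2}};B_R)=\inf\left\{\int_{B_R}|\nabla\varphi|^p\,dx\;:\;\varphi\in C^\infty_0(B_R),\ \varphi\ge 1\text{ on }\overline{B_{r_2}}\right\}. \] The problem \[ \min_{\varphi\in W^{1,p}_0(B_R)}\left\{\frac1p\int_{B_R}|\nabla\varphi|^p\,dx-\int_{S}\varphi\,dx\right\} \] has a unique minimizer $V$, and \[ \sup_{\varphi\in W^{1,p}_0(B_R)\setminus\{0\}}\frac{\left(\int_{S}|\varphi|\,dx\right)^p}{\int_{B_R}|\nabla\varphi|^p\,dx}=\left(\int_{B_R}|\nabla V|^p\,dx\right)^{p-1}, \] where \[ \int_{B_R}|\nabla V|^p\,dx=\int_{S}\left(\frac{|x|}{N}\left(1-\left(\frac{r_1}{|x|}\right)^N\right)\right)^{\frac p{p-1}}dx+|S|^{\frac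 p{p-1}}\left(\frac1{\mathrm{cap}_p(\overline{B_{r_2}};B_R)}\right)^{\frac1{p-1}}. \] In particular, for every $\varphi\in W^{1,p}_0(B_R)$, with $\mathcal H^{N-1}$ the $(N-1)$-dimensional Hausdorff measure (surface area), \[ \left(\frac{1}{|S|}\int_{S}|\varphi|\,dx\right)^p\le\left[\frac{|S|}{\left(\mathcal H^{N-1}(\partial B_{r_2})\right)^{\frac p{p-1}}}+\left(\frac1{\mathrm{cap}_p(\overline{B_{r_2}};B_R)}\right)^{\frac1{p-1}}\right]^{p-1}\int_{B_R}|\nabla\varphi|^p\,dx. \] -/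

import Mathlib

open MeasureTheory Metric Set
open scoped ContDiff Gradient ENNReal

noncomputable section

/-- `φ ∈ C^∞_0(Ω)`: smooth with compact support contained in `Ω`. -/
def IsTestFunction {N : ℕ} (Ω : Set (EuclideanSpace ℝ (Fin N)))
    (φ : EuclideanSpace ℝ (Fin N) → ℝ) : Prop :=
  ContDiff ℝ ∞ φ ∧ HasCompactSupport φ ∧ tsupport φ ⊆ Ω

/-- `G` is the weak (distributional) gradient of `u` on the open set `Ω`. Only the values of `u` and
`G` on `Ω` matter. -/
def IsWeakGradient {N : ℕ} (Ω : Set (EuclideanSpace ℝ (Fin N)))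
    (u : EuclideanSpace ℝ (Fin N) → ℝ)
    (G : EuclideanSpace ℝ (Fin N) → EuclideanSpace ℝ (Fin N)) : Prop :=
  LocallyIntegrableOn u Ω ∧ LocallyIntegrableOn G Ω ∧
    ∀ φ : EuclideanSpace ℝ (Fin N) → ℝ, IsTestFunction Ω φ →
      (∫ x in Ω, u x • ∇ φ x) = - ∫ x in Ω, φ x • G x

/-- `u ∈ W^{1,p}(Ω)` with weak gradient `G`. -/
def MemSobolev {N : ℕ} (p : ℝ) (Ω : Set (EuclideanSpace ℝ (Fin N)))
    (u : EuclideanSpace ℝ (Fin N) → ℝ)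
    (G : EuclideanSpace ℝ (Fin N) → EuclideanSpace ℝ (Fin N)) : Prop :=
  MemLp u (ENNReal.ofReal p) (volume.restrict Ω) ∧
    MemLp G (ENNReal.ofReal p) (volume.restrict Ω) ∧ IsWeakGradient Ω u G

/-- `u ∈ W^{1,p}_0(Ω)` with weak gradient `G`: `u` lies in the closure of `C^∞_0(Ω)` in
`W^{1,p}(Ω)`. -/
def MemSobolevZero {N : ℕ} (p : ℝ) (Ω : Set (EuclideanSpace ℝ (Fin N)))
    (u : EuclideanSpace ℝ (Fin N) → ℝ)
    (G : EuclideanSpace ℝ (Fin N) → EuclideanSpace ℝ (Fin N)) : Prop :=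
  MemSobolev p Ω u G ∧
    ∀ ε : ℝ≥0∞, 0 < ε → ∃ φ : EuclideanSpace ℝ (Fin N) → ℝ, IsTestFunction Ω φ ∧
      eLpNorm (fun x => u x - φ x) (ENNReal.ofReal p) (volume.restrict Ω) +
        eLpNorm (fun x => G x - ∇ φ x) (ENNReal.ofReal p) (volume.restrict Ω) < ε

/-- The `p`-capacity of a compact set `K` relative to an open set `Ω ⊇ K`. The set whose infimum is
taken is then nonempty and bounded below by `0`. -/
def relCapacity {N : ℕ} (p : ℝ) (K Ω : Set (EuclideanSpace ℝ (Fin N))) : ℝ :=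
  sInf {c : ℝ | ∃ φ : EuclideanSpace ℝ (Fin N) → ℝ, IsTestFunction Ω φ ∧ (∀ x ∈ K, 1 ≤ φ x) ∧
    c = ∫ x in Ω, ‖∇ φ x‖ ^ p}

/-- The open spherical shell `{x : r₁ < |x| < r₂}`. -/
def shell (N : ℕ) (r₁ r₂ : ℝ) : Set (EuclideanSpace ℝ (Fin N)) :=
  {x | r₁ < ‖x‖ ∧ ‖x‖ < r₂}

/-- The functional `φ ↦ (1/p) ∫_{B_R} |∇φ|^p - ∫_S φ` with `S` the shell, where `G = ∇φ`. -/
def torsionFunctional {N : ℕ} (p r₁ r₂ R : ℝ) (φ : EuclideanSpace ℝ (Fin N) → ℝ)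
    (G : EuclideanSpace ℝ (Fin N) → EuclideanSpace ℝ (Fin N)) : ℝ :=
  (1 / p) * (∫ x in ball (0 : EuclideanSpace ℝ (Fin N)) R, ‖G x‖ ^ p) - ∫ x in shell N r₁ r₂, φ x

/-- `V`, with weak gradient `DV`, minimizes the torsion functional over `W^{1,p}_0(B_R)`. -/
def IsTorsionMinimizer {N : ℕ} (p r₁ r₂ R : ℝ) (V : EuclideanSpace ℝ (Fin N) → ℝ)
    (DV : EuclideanSpace ℝ (Fin N) → EuclideanSpace ℝ (Fin N)) : Prop :=
  MemSobolevZero p (ball 0 R) V DV ∧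
    ∀ (φ : EuclideanSpace ℝ (Fin N) → ℝ)
      (Dφ : EuclideanSpace ℝ (Fin N) → EuclideanSpace ℝ (Fin N)), MemSobolevZero p (ball 0 R) φ Dφ →
      torsionFunctional p r₁ r₂ R V DV ≤ torsionFunctional p r₁ r₂ R φ Dφ

end

/-! ### Comparison of the Hausdorff measure of a sphere with its classical surface area. -/

section SphereMeasure

open Module Filter Topology
open scoped NNReal Pointwise RealInnerProductSpace

/-! The proof is a calibration argument. Let m be `fluxCoeff`; the field y ↦ -m(|y|) y has
divergence -1 on the shell S and 0 elsewhere, so ∫_S φ = -∫ m(|y|) ∇φ·y for every φ in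
W^{1,p}_0(B_R). This identity is obtained by writing φ as the integral of its radial derivative
along rays and exchanging the integrals, which also yields ∫_S |φ| ≤ ∫ |∇φ| |y| m(|y|) without
differentiating |φ|. Hölder's inequality then gives the Poincaré inequality with constant K^{p-1},
where K = ∫ (|y| m(|y|))^{p/(p-1)} is `fluxEnergy`.

Equality holds when |∇V|^{p-2}∇V = -m(|y|) y. The field is radial, so this is solved explicitly by
integrating (r m(r))^{1/(p-1)} inwards from R. The identity also turns the torsion functional into
the integral of a pointwise density whose unique pointwise minimizer, by strict Young, is ∇V. Hence
every minimizer has gradient ∇V almost everywhere, and a function of W^{1,p}_0 with zero gradient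
vanishes by the Poincaré inequality. Moreover ∫_S |V| = ∫ |∇V|^p = K, so V attains the supremum.

The value of K splits at r₂. Inside the shell the integrand is explicit; outside, r m(r) is |S|
divided by the area A(r) of the sphere, which produces |S|^{p/(p-1)} T with T = ∫_{r₂}^R
A(r)^{-1/(p-1)} dr. That T equals cap^{-1/(p-1)} follows from the Poincaré inequality on shells (a,
r₂) with a → r₂ for one bound, and from smoothed radial capacitary potentials for the other.

In the last inequality the shell part of K is bounded by its integrand at r₂. The Hausdorff measure
of the sphere enters only through a denominator, so it suffices that it is positive and at most
A(r₂). -/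

theorem LipschitzOnWith.euclideanHausdorffMeasure_image_le {X Y : Type*} [EMetricSpace X]
    [MeasurableSpace X] [BorelSpace X] [EMetricSpace Y] [MeasurableSpace Y] [BorelSpace Y]
    {f : X → Y} {s : Set X} (hf : LipschitzOnWith 1 f s) (d : ℕ) :
    μHE[d] (f '' s) ≤ μHE[d] s := by
  simp only [Measure.euclideanHausdorffMeasure_def, Measure.smul_apply]
  have := hf.hausdorffMeasure_image_le (d := (d : ℝ)) (by positivity)
  simp only [ENNReal.coe_one, ENNReal.one_rpow, one_mul] at this
  gcongr

variable {E : Type*} [NormedAddCommGroup E] [InnerProductSpace ℝ E]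

/-- Outside the open unit ball, the radial projection to the unit sphere is nonexpansive. -/
theorem lipschitzOnWith_inv_norm_smul :
    LipschitzOnWith 1 (fun x : E => ‖x‖⁻¹ • x) {x | 1 ≤ ‖x‖} := by
  refine LipschitzOnWith.of_dist_le_mul fun x hx y hy => ?_
  simp only [mem_ofPred_eq] at hx hy
  have hx0 : 0 < ‖x‖ := by linarith
  have hy0 : 0 < ‖y‖ := by linarith
  rw [NNReal.coe_one, one_mul, dist_eq_norm, dist_eq_norm]
  refine le_of_sq_le_sq ?_ (norm_nonneg _)
  rw [norm_sub_sq_real, norm_sub_sq_real, norm_smul, norm_smul, inner_smul_left, inner_smul_right]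
  simp only [norm_inv, norm_norm, RCLike.conj_to_real]
  rw [inv_mul_cancel₀ hx0.ne', inv_mul_cancel₀ hy0.ne']
  have hc := real_inner_le_norm x y
  set c := ⟪x, y⟫
  have h1 : ‖x‖⁻¹ * (‖y‖⁻¹ * c) = c / (‖x‖ * ‖y‖) := by field_simp
  have h2 : c / (‖x‖ * ‖y‖) ≤ 1 := by rw [div_le_one (by positivity)]; exact hc
  have h3 : c = (c / (‖x‖ * ‖y‖)) * (‖x‖ * ‖y‖) := by field_simp
  rw [h1]
  set d := c / (‖x‖ * ‖y‖)
  rw [h3]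
  have h4 : 1 ≤ ‖x‖ * ‖y‖ := by nlinarith
  nlinarith [sq_nonneg (‖x‖ - ‖y‖), mul_nonneg (sub_nonneg.2 h4) (sub_nonneg.2 h2)]

variable [MeasurableSpace E] [BorelSpace E]

theorem euclideanHausdorffMeasure_sphere_eq [Nontrivial E] {r : ℝ} (hr : 0 < r) (d : ℕ) :
    (μHE[d] : Measure E).real (sphere (0 : E) r) =
      r ^ d * (μHE[d] : Measure E).real (sphere (0 : E) 1) := by
  have : sphere (0 : E) r = r • sphere (0 : E) 1 := by
    rw [_root_.smul_sphere _ _ zero_le_one]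
    simp [abs_of_pos hr]
  rw [this, Measure.real, Measure.euclideanHausdorffMeasure_smul₀ d hr.ne', ENNReal.smul_def,
    smul_eq_mul, ENNReal.toReal_mul, Measure.real]
  simp [abs_of_pos hr]

variable [FiniteDimensional ℝ E]

/-- The surface measure of a small spherical cap is controlled by the volume of the cone over it. -/
theorem euclideanHausdorffMeasure_cap_le {v : E} (hv : ‖v‖ = 1) {r : ℝ} (hr : r < 1)
    (hr0 : 0 < r) :
    ENNReal.ofReal ((1 - r ^ 2 / 2) ^ finrank ℝ E) *
        μHE[finrank ℝ E - 1] (sphere (0 : E) 1 ∩ closedBall v r) ≤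
      finrank ℝ E * volume (Ioo (0 : ℝ) 1 • (sphere (0 : E) 1 ∩ closedBall v r)) := by
  have hv0 : v ≠ 0 := by rintro rfl; simp at hv
  have : Nontrivial E := ⟨v, 0, hv0⟩
  obtain ⟨n, hn⟩ : ∃ n, finrank ℝ E = n + 1 := ⟨finrank ℝ E - 1, by
    have : 0 < finrank ℝ E := finrank_pos
    omega⟩
  set C := sphere (0 : E) 1 ∩ closedBall v r with hC
  set c := 1 - r ^ 2 / 2 with hc
  have hc0 : 0 < c := by nlinarith
  have hCinner : ∀ y ∈ C, c ≤ ⟪y, v⟫ := by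
    rintro y ⟨hy1, hy2⟩
    rw [mem_sphere_zero_iff_norm] at hy1
    rw [mem_closedBall, dist_eq_norm] at hy2
    have h := norm_sub_sq_real y v
    rw [hy1, hv] at h
    have : ‖y - v‖ ^ 2 ≤ r ^ 2 := by gcongr
    linarith
  -- `D` is the central projection of the cap to the tangent hyperplane at `v`. It lies outside the
  -- open unit ball, where radial projection is nonexpansive, so the measure of `C` is at most that
  -- of `D`.
  set D := {z : E | ⟪z, v⟫ = 1 ∧ ‖z‖⁻¹ • z ∈ C} with hD
  have hDnorm : ∀ z ∈ D, 1 ≤ ‖z‖ := by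
    rintro z ⟨hz, -⟩
    have := real_inner_le_norm z v
    rwa [hz, hv, mul_one] at this
  have hDnorm' : ∀ z ∈ D, c * ‖z‖ ≤ 1 := by
    intro z hz
    have h1 := hCinner _ hz.2
    rw [inner_smul_left, hz.1] at h1
    have := hDnorm z hz
    simp only [RCLike.conj_to_real, mul_one] at h1
    rwa [le_inv_comm₀ hc0 (by linarith), ← one_div, le_div_iff₀ hc0, mul_comm] at h1
  have hCD : C ⊆ (fun x : E => ‖x‖⁻¹ • x) '' D := by
    intro y hy
    have h1 := hCinner y hy
    have hpos : 0 < ⟪y, v⟫ := by linarith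
    have hy1 : ‖y‖ = 1 := mem_sphere_zero_iff_norm.1 hy.1
    have key : ‖(⟪y, v⟫)⁻¹ • y‖⁻¹ • (⟪y, v⟫)⁻¹ • y = y := by
      rw [norm_smul, hy1, mul_one, Real.norm_of_nonneg (by positivity), inv_inv, smul_smul,
        mul_inv_cancel₀ hpos.ne', one_smul]
    refine ⟨(⟪y, v⟫)⁻¹ • y, ⟨?_, ?_⟩, key⟩
    · rw [inner_smul_left]; simp [hpos.ne']
    · rw [key]; exact hy
  have hCle : μHE[n] C ≤ μHE[n] D :=
    (measure_mono hCD).trans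
      ((lipschitzOnWith_inv_norm_smul.mono hDnorm).euclideanHausdorffMeasure_image_le n)
  have hmeas : MeasurableSet (Ioo (0 : ℝ) 1 • C) := by
    have : Ioo (0 : ℝ) 1 • C = {y | y ≠ 0 ∧ ‖y‖ < 1 ∧ ‖y‖⁻¹ • y ∈ C} := by
      ext y
      simp only [Set.mem_smul, mem_ofPred_eq]
      constructor
      · rintro ⟨t, ht, x, hx, rfl⟩
        have hx1 : ‖x‖ = 1 := mem_sphere_zero_iff_norm.1 hx.1
        have hx0 : x ≠ 0 := by rintro rfl; simp at hx1
        rw [norm_smul, hx1, mul_one, Real.norm_of_nonneg ht.1.le, smul_smul,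
          inv_mul_cancel₀ ht.1.ne', one_smul]
        exact ⟨smul_ne_zero ht.1.ne' hx0, ht.2, hx⟩
      · rintro ⟨h0, h1, h2⟩
        refine ⟨‖y‖, ⟨norm_pos_iff.2 h0, h1⟩, _, h2, ?_⟩
        simp only [smul_smul]
        rw [mul_inv_cancel₀ (norm_ne_zero_iff.2 h0), one_smul]
    rw [this]
    have hCm : MeasurableSet C := (isClosed_sphere.inter isClosed_closedBall).measurableSet
    refine (measurableSet_singleton (0 : E)).compl.inter
      ((measurableSet_lt measurable_norm measurable_const).inter ?_)
    exact (measurable_norm.inv.smul measurable_id) hCm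
  -- At every height `x < c` the slice of the cone contains the dilate `x • D`: points of `D` have
  -- norm at most `1 / c`, so those of `x • D` stay inside the unit ball.
  have hsec : ∀ x ∈ Ioo 0 c, ENNReal.ofReal (x ^ n) * μHE[n] D ≤
      μHE[n] (Ioo (0 : ℝ) 1 • C ∩ AffineSubspace.mk' (x • v +ᵥ (0 : E)) (ℝ ∙ v)ᗮ) := by
    intro x hx
    have h1 : μHE[n] (x • D) = ENNReal.ofReal (x ^ n) * μHE[n] D := by
      rw [Measure.euclideanHausdorffMeasure_smul₀ n hx.1.ne', ENNReal.smul_def, smul_eq_mul]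
      congr 1
      rw [ENNReal.coe_pow, ENNReal.ofReal_pow hx.1.le, ← enorm_eq_nnnorm,
        Real.enorm_eq_ofReal hx.1.le]
    rw [← h1]
    refine measure_mono ?_
    rintro _ ⟨z, hz, rfl⟩
    have hz1 := hDnorm z hz
    refine ⟨⟨x * ‖z‖, ⟨by have := hx.1; positivity, ?_⟩, _, hz.2, ?_⟩, ?_⟩
    · have h2 := hDnorm' z hz
      have : x * ‖z‖ < c * ‖z‖ := by have := hx.2; gcongr
      linarith
    · simp only [smul_smul]
      rw [mul_assoc, mul_inv_cancel₀ (by linarith), mul_one]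
    · simp only [vadd_eq_add, add_zero, SetLike.mem_coe, AffineSubspace.mem_mk', vsub_eq_sub]
      rw [Submodule.mem_orthogonal_singleton_iff_inner_left, ← smul_sub, inner_smul_left,
        inner_sub_left, hz.1, real_inner_self_eq_norm_sq, hv]
      simp
  have hvol : volume (Ioo (0 : ℝ) 1 • C) =
      ∫⁻ x : ℝ, μHE[n] (Ioo (0 : ℝ) 1 • C ∩ AffineSubspace.mk' (x • v +ᵥ (0 : E)) (ℝ ∙ v)ᗮ) := by
    rw [← InnerProductSpace.euclideanHausdorffMeasure_eq_volume,
      EuclideanGeometry.euclideanHausdorffMeasure_eq_lintegral (0 : E) hv0 hmeas]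
    simp only [hn, Nat.add_sub_cancel]
    rw [← ofReal_norm, hv]; simp
  have hintegrable : ∫⁻ x in Ioo 0 c, ENNReal.ofReal (x ^ n) = ENNReal.ofReal (c ^ (n + 1) / (n + 1)) := by
    rw [Measure.restrict_congr_set Ioo_ae_eq_Ioc,
      ← ofReal_integral_eq_lintegral_ofReal (intervalIntegral.intervalIntegrable_pow _).1,
      ← intervalIntegral.integral_of_le hc0.le]
    · simp
    · filter_upwards [ae_restrict_mem measurableSet_Ioc] with y hy
      exact pow_nonneg hy.1.le _
  simp only [hn, Nat.add_sub_cancel]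
  calc ENNReal.ofReal (c ^ (n + 1)) * μHE[n] C
      ≤ ENNReal.ofReal (c ^ (n + 1)) * μHE[n] D := by gcongr
    _ = ((n + 1 : ℕ) : ℝ≥0∞) * (ENNReal.ofReal (c ^ (n + 1) / (n + 1)) * μHE[n] D) := by
        rw [← mul_assoc, ← ENNReal.ofReal_natCast, ← ENNReal.ofReal_mul (by positivity)]
        congr 2
        push_cast
        field_simp
    _ = ((n + 1 : ℕ) : ℝ≥0∞) * ∫⁻ x in Ioo 0 c, ENNReal.ofReal (x ^ n) * μHE[n] D := by
        rw [lintegral_mul_const _ (by fun_prop), hintegrable]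
    _ ≤ ((n + 1 : ℕ) : ℝ≥0∞) * volume (Ioo (0 : ℝ) 1 • C) := by
        gcongr
        rw [hvol]
        exact (setLIntegral_mono' measurableSet_Ioo hsec).trans (setLIntegral_le_lintegral _ _)

/-- On small caps the Hausdorff measure exceeds the cone measure `toSphere` by a factor tending to
1, and the Besicovitch covering theorem turns this local comparison into a global one. -/
theorem euclideanHausdorffMeasure_unitSphere_le [Nontrivial E] :
    μHE[finrank ℝ E - 1] (sphere (0 : E) 1) ≤ finrank ℝ E * volume (ball (0 : E) 1) := by
  set n := finrank ℝ E
  set ρ : Measure E := (μHE[n - 1]).restrict (sphere (0 : E) 1) with hρ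
  set ν : Measure E := (volume : Measure E).toSphere.map Subtype.val with hν
  have hνapp : ∀ (x : E) (r : ℝ), ν (closedBall x r) =
      n * volume (Ioo (0 : ℝ) 1 • (sphere (0 : E) 1 ∩ closedBall x r)) := by
    intro x r
    rw [hν, Measure.map_apply measurable_subtype_coe measurableSet_closedBall,
      Measure.toSphere_apply' _ (measurable_subtype_coe measurableSet_closedBall),
      Subtype.image_preimage_coe]
  have hρapp : ∀ (x : E) (r : ℝ), ρ (closedBall x r) =
      μHE[n - 1] (sphere (0 : E) 1 ∩ closedBall x r) := by
    intro x r
    rw [hρ, Measure.restrict_apply measurableSet_closedBall, inter_comm]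
  have hcap : ∀ x ∈ sphere (0 : E) 1, ∀ r, 0 < r → r < 1 →
      ENNReal.ofReal ((1 - r ^ 2 / 2) ^ n) * ρ (closedBall x r) ≤ ν (closedBall x r) := by
    intro x hx r hr0 hr1
    rw [hνapp, hρapp]
    exact euclideanHausdorffMeasure_cap_le (mem_sphere_zero_iff_norm.1 hx) hr1 hr0
  have hfinν : IsFiniteMeasure ν := by rw [hν]; infer_instance
  have hfin : μHE[n - 1] (sphere (0 : E) 1) < ⊤ := by
    refine (isCompact_sphere (0 : E) 1).measure_lt_top_of_nhdsWithin fun x hx => ?_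
    refine ⟨sphere (0 : E) 1 ∩ closedBall x (1 / 2), ?_, ?_⟩
    · exact inter_mem self_mem_nhdsWithin
        (mem_nhdsWithin_of_mem_nhds (closedBall_mem_nhds x (by norm_num)))
    · rw [← hρapp]
      have h := (hcap x hx (1 / 2) (by norm_num) (by norm_num)).trans_lt (measure_lt_top _ _)
      refine ENNReal.lt_top_of_mul_ne_top_right h.ne ?_
      rw [ne_eq, ENNReal.ofReal_eq_zero, not_le]
      norm_num
  have hfinρ : IsFiniteMeasure ρ := ⟨by rw [hρ, Measure.restrict_apply_univ]; exact hfin⟩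
  have hle : ∀ c : ℝ≥0, c < 1 → (c • ρ) (sphere (0 : E) 1) ≤ ν (sphere (0 : E) 1) := by
    intro c hc
    refine (Besicovitch.vitaliFamily ρ).measure_le_of_frequently_le ν
      Measure.smul_absolutelyContinuous _ fun x hx => ?_
    refine (Besicovitch.tendsto_filterAt ρ x).frequently (Eventually.frequently ?_)
    have hlim : Tendsto (fun r : ℝ => (1 - r ^ 2 / 2) ^ n) (𝓝[>] 0) (𝓝 1) := by
      have : Continuous fun r : ℝ => (1 - r ^ 2 / 2) ^ n := by fun_prop
      have h := this.tendsto 0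
      simp only [ne_eq, OfNat.ofNat_ne_zero, not_false_eq_true, zero_pow, zero_div, sub_zero,
        one_pow] at h
      exact h.mono_left nhdsWithin_le_nhds
    filter_upwards [hlim.eventually (lt_mem_nhds (show (c : ℝ) < 1 by exact_mod_cast hc)),
      Ioo_mem_nhdsGT (show (0 : ℝ) < 1 by norm_num)] with r hr hr'
    refine le_trans ?_ (hcap x hx r hr'.1 hr'.2)
    rw [Measure.smul_apply]
    change (c : ℝ≥0∞) * _ ≤ _
    gcongr
    rw [← ENNReal.ofReal_coe_nnreal]
    exact ENNReal.ofReal_le_ofReal hr.le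
  have hν' : ν (sphere (0 : E) 1) ≤ n * volume (ball (0 : E) 1) := by
    refine (measure_mono (subset_univ _)).trans ?_
    rw [hν, Measure.map_apply measurable_subtype_coe MeasurableSet.univ, preimage_univ,
      Measure.toSphere_apply_univ]
  have hρs : ρ (sphere (0 : E) 1) = μHE[n - 1] (sphere (0 : E) 1) := by
    rw [hρ, Measure.restrict_apply_self]
  rw [← hρs]
  refine le_trans ?_ hν'
  refine ENNReal.le_of_forall_nnreal_lt fun s hs => ?_
  by_contra! hcon
  have hs0 : 0 < s := by
    rcases eq_or_ne s 0 with rfl | h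
    · simp at hcon
    · exact pos_iff_ne_zero.2 h
  obtain ⟨m, hm⟩ : ∃ m : ℝ≥0, ρ (sphere (0 : E) 1) = m :=
    ⟨_, (ENNReal.coe_toNNReal (measure_ne_top _ _)).symm⟩
  have hsm : s < m := by rw [hm] at hs; exact_mod_cast hs
  have hm0 : 0 < m := hs0.trans hsm
  -- The factor is chosen so that `s / m` times the measure `m` of the sphere is exactly `s`.
  have := hle (s / m) (by rw [div_lt_one hm0]; exact hsm)
  rw [Measure.smul_apply, hm, ENNReal.smul_def, smul_eq_mul, ← ENNReal.coe_mul,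
    div_mul_cancel₀ _ hm0.ne'] at this
  exact absurd this (not_le.2 hcon)

/-- Orthogonal projection to the hyperplane orthogonal to `v` is nonexpansive and maps the sphere
onto a set containing the open unit ball of that hyperplane, which has positive volume. -/
theorem euclideanHausdorffMeasure_unitSphere_pos [Nontrivial E] :
    0 < μHE[finrank ℝ E - 1] (sphere (0 : E) 1) := by
  obtain ⟨v, hv⟩ := exists_norm_eq E (zero_le_one' ℝ)
  have hv0 : v ≠ 0 := by rintro rfl; simp at hv
  have hrank : finrank ℝ (ℝ ∙ v)ᗮ = finrank ℝ E - 1 := by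
    have := (ℝ ∙ v).finrank_add_finrank_orthogonal
    rw [finrank_span_singleton hv0] at this
    omega
  set P := (ℝ ∙ v)ᗮ.orthogonalProjectionOnto
  have hsub : ball (0 : (ℝ ∙ v)ᗮ) 1 ⊆ P '' sphere (0 : E) 1 := by
    intro w hw
    have hw1 : ‖(w : E)‖ < 1 := by simpa using hw
    have hwv : ⟪(w : E), v⟫ = 0 := Submodule.mem_orthogonal_singleton_iff_inner_left.1 w.2
    have h0 : 0 ≤ 1 - ‖(w : E)‖ ^ 2 := by nlinarith [norm_nonneg (w : E)]
    refine ⟨(w : E) + √(1 - ‖(w : E)‖ ^ 2) • v, ?_, ?_⟩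
    · rw [mem_sphere_zero_iff_norm]
      refine (sq_eq_sq₀ (norm_nonneg _) zero_le_one).1 ?_
      rw [norm_add_sq_real, inner_smul_right, hwv, norm_smul, hv, mul_one, Real.norm_eq_abs,
        sq_abs, Real.sq_sqrt h0]
      ring
    · have h2 : P v = 0 :=
        Submodule.orthogonalProjectionOnto_orthogonalComplement_singleton_eq_zero v
      rw [map_add, map_smul, h2, smul_zero, add_zero]
      exact Submodule.orthogonalProjectionOnto_mem_subspace_eq_self w
  have hlip : LipschitzOnWith 1 P (sphere (0 : E) 1) := by
    refine (LipschitzWith.of_dist_le_mul fun x y => ?_).lipschitzOnWith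
    rw [dist_eq_norm, dist_eq_norm, ← map_sub, NNReal.coe_one, one_mul]
    exact Submodule.norm_orthogonalProjectionOnto_apply_le _ _
  refine lt_of_lt_of_le ?_ (hlip.euclideanHausdorffMeasure_image_le _)
  refine lt_of_lt_of_le ?_ (measure_mono hsub)
  rw [← hrank, InnerProductSpace.euclideanHausdorffMeasure_eq_volume]
  exact measure_ball_pos _ _ one_pos

/-- Positivity matters because division by a zero area would return 0 and spoil the final constant;
the upper bound makes that constant no smaller than the one with the classical area. -/
theorem euclideanHausdorffMeasure_sphere_mem_Ioc [Nontrivial E] {r : ℝ} (hr : 0 < r) :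
    (μHE[finrank ℝ E - 1] : Measure E).real (sphere (0 : E) r) ∈
      Ioc 0 (finrank ℝ E * volume.real (ball (0 : E) 1) * r ^ (finrank ℝ E - 1)) := by
  have hle := euclideanHausdorffMeasure_unitSphere_le (E := E)
  have hpos := euclideanHausdorffMeasure_unitSphere_pos (E := E)
  have hfin : (finrank ℝ E : ℝ≥0∞) * volume (ball (0 : E) 1) ≠ ⊤ :=
    ENNReal.mul_ne_top (by simp) measure_ball_lt_top.ne
  rw [euclideanHausdorffMeasure_sphere_eq hr]
  constructor
  · have := ENNReal.toReal_pos hpos.ne' (ne_top_of_le_ne_top hfin hle)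
    rw [Measure.real]
    positivity
  · rw [mul_comm]
    gcongr
    have := ENNReal.toReal_mono hfin hle
    simpa [Measure.real] using this

end SphereMeasure

/-! ### The flux field, derived by integration along rays. -/

section Flux

open Module Filter Topology

/-- The radial function `m` for which the field `-m(|x|) x` vanishes on `B_a` and has divergence
`-1` on the shell `a < |x| < b` and `0` elsewhere. -/
noncomputable def fluxCoeff (n : ℕ) (a b r : ℝ) : ℝ :=
  ((max a (min r b)) ^ n - a ^ n) / (n * r ^ n)

theorem measurable_fluxCoeff (n : ℕ) (a b : ℝ) : Measurable (fluxCoeff n a b) := by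
  unfold fluxCoeff
  fun_prop

theorem fluxCoeff_nonneg {n : ℕ} {a b r : ℝ} (ha : 0 < a) (hr : 0 ≤ r) : 0 ≤ fluxCoeff n a b r := by
  unfold fluxCoeff
  have : a ^ n ≤ (max a (min r b)) ^ n := by gcongr; exact le_max_left _ _
  exact div_nonneg (sub_nonneg.2 this) (by positivity)

theorem fluxCoeff_eq_zero {n : ℕ} {a b r : ℝ} (hr : r ≤ a) : fluxCoeff n a b r = 0 := by
  unfold fluxCoeff
  rw [max_eq_left ((min_le_left _ _).trans hr), sub_self, zero_div]

theorem fluxCoeff_le_one {n : ℕ} (hn : n ≠ 0) {a b r : ℝ} (ha : 0 < a) :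
    fluxCoeff n a b r ≤ 1 := by
  rcases le_total r a with h | h
  · rw [fluxCoeff_eq_zero h]; exact zero_le_one
  have hr0 : 0 < r := by linarith
  have h1 : max a (min r b) ^ n ≤ r ^ n := by
    gcongr
    exact max_le h (min_le_left _ _)
  have h2 : (1 : ℝ) ≤ n := by exact_mod_cast Nat.one_le_iff_ne_zero.2 hn
  unfold fluxCoeff
  rw [div_le_one (by positivity)]
  have h3 : 0 < a ^ n := by positivity
  have h4 : 0 < r ^ n := by positivity
  nlinarith

/-- The flux coefficient is the weight that a point at distance `r` receives from all points `r / t`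
of the shell from which an outgoing ray reaches it. -/
theorem fluxCoeff_eq_setIntegral {n : ℕ} (hn : n ≠ 0) {a b r T : ℝ} (ha : 0 < a) (hab : a < b)
    (hr : 0 < r) (hT : r / a ≤ T) :
    ∫ t in Ioc 1 T, (if a < t⁻¹ * r ∧ t⁻¹ * r < b then (t ^ (n + 1))⁻¹ else 0) =
      fluxCoeff n a b r := by
  have hb : 0 < b := ha.trans hab
  set α := max 1 (r / b) with hα
  have hα1 : 1 ≤ α := le_max_left _ _
  have hset : ∀ t ∈ Ioc 1 T, (if a < t⁻¹ * r ∧ t⁻¹ * r < b then (t ^ (n + 1))⁻¹ else 0) =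
      (Ioo (r / b) (r / a)).indicator (fun t : ℝ => (t ^ (n + 1))⁻¹) t := by
    intro t ht
    have ht0 : 0 < t := by linarith [ht.1]
    have h1 : a < t⁻¹ * r ↔ t < r / a := by
      rw [inv_mul_eq_div, lt_div_iff₀ ht0, lt_div_iff₀ ha, mul_comm]
    have h2 : t⁻¹ * r < b ↔ r / b < t := by
      rw [inv_mul_eq_div, div_lt_iff₀ ht0, div_lt_iff₀ hb, mul_comm]
    simp only [h1, h2, indicator, mem_Ioo, and_comm]
  rw [setIntegral_congr_fun measurableSet_Ioc hset, setIntegral_indicator measurableSet_Ioo]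
  have hI : Ioc 1 T ∩ Ioo (r / b) (r / a) = Ioo α (r / a) := by
    ext t
    simp only [mem_inter_iff, mem_Ioc, mem_Ioo, hα, max_lt_iff]
    constructor
    · rintro ⟨⟨h1, _⟩, h2, h3⟩; exact ⟨⟨h1, h2⟩, h3⟩
    · rintro ⟨⟨h1, h2⟩, h3⟩; exact ⟨⟨h1, h3.le.trans hT⟩, h2, h3⟩
  rw [hI]
  rcases le_or_gt r a with h | h
  · rw [fluxCoeff_eq_zero h, Ioo_eq_empty, setIntegral_empty]
    have : r / a ≤ 1 := (div_le_one ha).2 h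
    linarith
  have hαle : α ≤ r / a := by
    refine max_le ((one_le_div ha).2 h.le) ?_
    gcongr
  rw [← integral_Ioc_eq_integral_Ioo, ← intervalIntegral.integral_of_le hαle]
  have hderiv : ∀ t ∈ uIcc α (r / a),
      HasDerivAt (fun t : ℝ => -((t ^ n)⁻¹ / n)) ((t ^ (n + 1))⁻¹) t := by
    intro t ht
    rw [uIcc_of_le hαle] at ht
    have ht0 : 0 < t := by linarith [ht.1]
    have h1 := (((hasDerivAt_pow n t).inv (by positivity)).div_const (n : ℝ)).neg
    refine h1.congr_deriv ?_
    obtain ⟨k, rfl⟩ : ∃ k, n = k + 1 := ⟨n - 1, by omega⟩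
    have : ((k + 1 : ℕ) : ℝ) ≠ 0 := by positivity
    simp only [Nat.add_sub_cancel]
    field_simp
    ring
  have hcont : ContinuousOn (fun t : ℝ => (t ^ (n + 1))⁻¹) (uIcc α (r / a)) := by
    refine ContinuousOn.inv₀ (by fun_prop) fun t ht => ?_
    rw [uIcc_of_le hαle] at ht
    have ht0 : 0 < t := by linarith [ht.1]
    positivity
  rw [intervalIntegral.integral_eq_sub_of_hasDerivAt hderiv hcont.intervalIntegrable]
  -- The lower limit `α` is 1 for `r` in the shell and `r / b` beyond it, which is where the
  -- truncation of `r` at `b` comes from.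
  have hmin : max a (min r b) = r / α := by
    rw [max_eq_right (le_min h.le hab.le), hα]
    rcases le_total r b with hrb | hrb
    · rw [min_eq_left hrb, max_eq_left ((div_le_one hb).2 hrb), div_one]
    · rw [min_eq_right hrb, max_eq_right ((one_le_div hb).2 hrb)]
      field_simp
  have hn' : (n : ℝ) ≠ 0 := by exact_mod_cast hn
  have hα0 : α ≠ 0 := by linarith
  unfold fluxCoeff
  rw [hmin, div_pow, div_pow]
  field_simp
  ring

variable {E : Type*} [NormedAddCommGroup E] [InnerProductSpace ℝ E]

/-- A compactly supported function is recovered from its radial derivative. -/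
theorem neg_integral_ray_fderiv_eq {φ : E → ℝ} (hφ : ContDiff ℝ 1 φ) {R a : ℝ}
    (hφR : ∀ x, R ≤ ‖x‖ → φ x = 0) (ha : 0 < a) (haR : a ≤ R) {x : E} (hx : a ≤ ‖x‖) :
    φ x = -∫ t in Ioc 1 (R / a), t⁻¹ * (fderiv ℝ φ (t • x) (t • x)) := by
  have h1T : 1 ≤ R / a := (one_le_div ha).2 haR
  have hT : φ ((R / a) • x) = 0 := by
    refine hφR _ ?_
    rw [norm_smul, Real.norm_of_nonneg (by linarith)]
    calc R = R / a * a := by field_simp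
      _ ≤ R / a * ‖x‖ := by gcongr
  have hderiv : ∀ t ∈ uIcc 1 (R / a), HasDerivAt (fun t : ℝ => φ (t • x))
      (fderiv ℝ φ (t • x) x) t := by
    intro t _
    have h1 : HasDerivAt (fun t : ℝ => t • x) x t := by
      simpa using (hasDerivAt_id t).smul_const x
    exact ((hφ.differentiable one_ne_zero).differentiableAt.hasFDerivAt (x := t • x)).comp_hasDerivAt t h1
  have hcont : Continuous fun t : ℝ => fderiv ℝ φ (t • x) x := by
    have := hφ.continuous_fderiv one_ne_zero
    fun_prop
  have hftc := intervalIntegral.integral_eq_sub_of_hasDerivAt hderiv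
    (hcont.intervalIntegrable _ _)
  rw [hT, one_smul, zero_sub, intervalIntegral.integral_of_le h1T] at hftc
  rw [← neg_eq_iff_eq_neg, ← hftc]
  refine setIntegral_congr_fun measurableSet_Ioc fun t ht => ?_
  have ht0 : t ≠ 0 := by linarith [ht.1]
  rw [map_smul, smul_eq_mul, inv_mul_cancel_left₀ ht0]

variable [FiniteDimensional ℝ E] [MeasurableSpace E] [BorelSpace E]

/-- Integrability on a shell times a bounded interval of the integrand along rays. -/
theorem integrable_uncurry_ray {f : E → ℝ} (hf : Continuous f) (hcs : HasCompactSupport f)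
    (a b T : ℝ) :
    Integrable (Function.uncurry fun (x : E) (t : ℝ) => t⁻¹ * f (t • x))
      ((volume.restrict {x : E | a < ‖x‖ ∧ ‖x‖ < b}).prod (volume.restrict (Ioc 1 T))) := by
  set S := {x : E | a < ‖x‖ ∧ ‖x‖ < b}
  have hSfin : volume S < ⊤ := by
    refine (measure_mono (t := ball (0 : E) b) fun x hx => ?_).trans_lt measure_ball_lt_top
    simpa using hx.2
  obtain ⟨C, hC⟩ := hcs.exists_bound_of_continuous hf
  have hSfin' : IsFiniteMeasure (volume.restrict S) := ⟨by simpa using hSfin⟩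
  refine Integrable.of_bound (C := C) ?_ ?_
  · refine (Measurable.mul ?_ ?_).aestronglyMeasurable
    · exact measurable_snd.inv
    · exact hf.measurable.comp (measurable_snd.smul measurable_fst)
  · have : ∀ᵐ z ∂((volume.restrict S).prod (volume.restrict (Ioc 1 T))), z.2 ∈ Ioc 1 T :=
      Measure.quasiMeasurePreserving_snd.ae (ae_restrict_mem measurableSet_Ioc)
    filter_upwards [this] with z hz
    simp only [Function.uncurry]
    rw [norm_mul, norm_inv, Real.norm_of_nonneg (by linarith [hz.1])]
    have h2 : z.2⁻¹ ≤ 1 := inv_le_one_of_one_le₀ hz.1.le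
    calc z.2⁻¹ * ‖f (z.2 • z.1)‖ ≤ 1 * ‖f (z.2 • z.1)‖ := by gcongr
      _ ≤ C := by rw [one_mul]; exact hC _

/-- Integrating `f` along the rays leaving a shell. -/
theorem integral_shell_integral_ray [Nontrivial E] {f : E → ℝ} (hf : Continuous f) {R a b : ℝ}
    (hfR : ∀ x, R ≤ ‖x‖ → f x = 0) (ha : 0 < a) (hab : a < b) :
    ∫ x in {x : E | a < ‖x‖ ∧ ‖x‖ < b}, ∫ t in Ioc 1 (R / a), t⁻¹ * f (t • x) =
      ∫ y, f y * fluxCoeff (finrank ℝ E) a b ‖y‖ := by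
  set n := finrank ℝ E with hn
  have hn0 : n ≠ 0 := (finrank_pos (R := ℝ) (M := E)).ne'
  set S := {x : E | a < ‖x‖ ∧ ‖x‖ < b} with hS
  set T := R / a
  have hSm : MeasurableSet S :=
    (measurableSet_lt measurable_const measurable_norm).inter
      (measurableSet_lt measurable_norm measurable_const)
  have hcs : HasCompactSupport f :=
    HasCompactSupport.of_support_subset_isCompact (isCompact_closedBall (0 : E) R) fun x hx => by
      rw [mem_closedBall_zero_iff]
      by_contra! h
      exact hx (hfR x h.le)
  have hfint : Integrable f := hf.integrable_of_hasCompactSupport hcs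
  have h1 := integrable_uncurry_ray hf hcs a b T
  rw [integral_integral_swap h1]
  have h2 : ∀ t ∈ Ioc 1 T, ∫ x in S, t⁻¹ * f (t • x) =
      ∫ y, (if a < t⁻¹ * ‖y‖ ∧ t⁻¹ * ‖y‖ < b then (t ^ (n + 1))⁻¹ else 0) * f y := by
    intro t ht
    have ht0 : 0 < t := by linarith [ht.1]
    -- The dilation `y = t • x` contributes `t⁻ⁿ`, which joins the factor `t⁻¹` already present.
    have h3 := Measure.integral_comp_smul_of_nonneg (volume : Measure E)
      (fun y => (if a < t⁻¹ * ‖y‖ ∧ t⁻¹ * ‖y‖ < b then t⁻¹ else 0) * f y) t (hR := ht0.le)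
    rw [← integral_indicator hSm]
    calc _ = ∫ x, (if a < t⁻¹ * ‖t • x‖ ∧ t⁻¹ * ‖t • x‖ < b then t⁻¹ else 0) * f (t • x) := by
          congr 1
          ext x
          rw [norm_smul, Real.norm_of_nonneg ht0.le, inv_mul_cancel_left₀ ht0.ne']
          simp only [indicator, hS, mem_ofPred_eq]
          split_ifs <;> simp
      _ = _ := by
          rw [h3, smul_eq_mul, ← integral_const_mul]
          congr 1
          ext y
          rw [← hn, pow_succ]
          split_ifs
          · rw [mul_inv]; ring
          · simp
  rw [setIntegral_congr_fun measurableSet_Ioc h2]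
  have h4 : Integrable (Function.uncurry fun (t : ℝ) (y : E) =>
      (if a < t⁻¹ * ‖y‖ ∧ t⁻¹ * ‖y‖ < b then (t ^ (n + 1))⁻¹ else 0) * f y)
      ((volume.restrict (Ioc 1 T)).prod volume) := by
    refine (hfint.comp_snd (volume.restrict (Ioc 1 T))).norm.mono' ?_ ?_
    · refine (Measurable.mul ?_ (hf.measurable.comp measurable_snd)).aestronglyMeasurable
      refine Measurable.ite ?_ (by fun_prop) measurable_const
      have hm : Measurable fun z : ℝ × E => z.1⁻¹ * ‖z.2‖ := by fun_prop
      exact (measurableSet_lt measurable_const hm).inter (measurableSet_lt hm measurable_const)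
    · have : ∀ᵐ z ∂((volume.restrict (Ioc 1 T)).prod (volume : Measure E)), z.1 ∈ Ioc 1 T :=
        Measure.quasiMeasurePreserving_fst.ae (ae_restrict_mem measurableSet_Ioc)
      filter_upwards [this] with z hz
      simp only [Function.uncurry]
      rw [norm_mul]
      refine mul_le_of_le_one_left (norm_nonneg _) ?_
      have h0 : 0 < z.1 := by linarith [hz.1]
      split_ifs
      · rw [norm_inv, Real.norm_of_nonneg (by positivity)]
        exact inv_le_one_of_one_le₀ (one_le_pow₀ hz.1.le)
      · simp
  rw [integral_integral_swap h4]
  congr 1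
  ext y
  rw [integral_mul_const, mul_comm]
  rcases eq_or_ne y 0 with rfl | hy
  · rw [fluxCoeff_eq_zero (by simpa using ha.le)]
    simp [not_lt.2 ha.le]
  -- Stopping the rays at `t = R / a` loses nothing: `f` vanishes for `R ≤ ‖y‖`, and for `‖y‖ < R`
  -- the weight is already complete at `‖y‖ / a ≤ R / a`.
  rcases le_or_gt R ‖y‖ with h | h
  · simp [hfR y h]
  · rw [fluxCoeff_eq_setIntegral hn0 ha hab (norm_pos_iff.2 hy)]
    exact div_le_div_of_nonneg_right h.le ha.le

end Flux

/-! ### The flux identity and inequality, from test functions to their limits. -/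

section TestLimit

open Module Filter Topology

variable {N : ℕ}

theorem measurableSet_shell (a b : ℝ) : MeasurableSet (shell N a b) :=
  (measurableSet_lt measurable_const measurable_norm).inter
    (measurableSet_lt measurable_norm measurable_const)

theorem shell_subset_ball {a b R : ℝ} (hbR : b ≤ R) : shell N a b ⊆ ball 0 R := fun _ hx =>
  mem_ball_zero_iff.2 (hx.2.trans_le hbR)

theorem IsTestFunction.eq_zero {R : ℝ} {φ : EuclideanSpace ℝ (Fin N) → ℝ}
    (hφ : IsTestFunction (ball 0 R) φ) {x : EuclideanSpace ℝ (Fin N)} (hx : R ≤ ‖x‖) : φ x = 0 := by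
  by_contra h
  have := mem_ball_zero_iff.1 (hφ.2.2 (subset_tsupport _ h))
  linarith

theorem IsTestFunction.fderiv_eq_zero {R : ℝ} {φ : EuclideanSpace ℝ (Fin N) → ℝ}
    (hφ : IsTestFunction (ball 0 R) φ) {x : EuclideanSpace ℝ (Fin N)} (hx : R ≤ ‖x‖) :
    fderiv ℝ φ x = 0 := by
  by_contra h
  have := mem_ball_zero_iff.1 (hφ.2.2 (support_fderiv_subset ℝ h))
  linarith

theorem IsTestFunction.continuous_gradient {Ω : Set (EuclideanSpace ℝ (Fin N))}
    {φ : EuclideanSpace ℝ (Fin N) → ℝ} (hφ : IsTestFunction Ω φ) : Continuous (∇ φ) :=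
  (InnerProductSpace.toDual ℝ _).symm.continuous.comp
    (hφ.1.continuous_fderiv (by simp))

theorem IsTestFunction.hasCompactSupport_gradient {Ω : Set (EuclideanSpace ℝ (Fin N))}
    {φ : EuclideanSpace ℝ (Fin N) → ℝ} (hφ : IsTestFunction Ω φ) : HasCompactSupport (∇ φ) :=
  (hφ.2.1.fderiv (𝕜 := ℝ)).comp_left (g := (InnerProductSpace.toDual ℝ _).symm) (map_zero _)

theorem IsTestFunction.sub {Ω : Set (EuclideanSpace ℝ (Fin N))}
    {φ ψ : EuclideanSpace ℝ (Fin N) → ℝ} (hφ : IsTestFunction Ω φ) (hψ : IsTestFunction Ω ψ) :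
    IsTestFunction Ω (φ - ψ) := by
  refine ⟨hφ.1.sub hψ.1, hφ.2.1.sub hψ.2.1, ?_⟩
  exact (tsupport_sub φ ψ).trans (union_subset hφ.2.2 hψ.2.2)

theorem IsTestFunction.gradient_sub {Ω : Set (EuclideanSpace ℝ (Fin N))}
    {φ ψ : EuclideanSpace ℝ (Fin N) → ℝ} (hφ : IsTestFunction Ω φ) (hψ : IsTestFunction Ω ψ)
    (x : EuclideanSpace ℝ (Fin N)) : ∇ (φ - ψ) x = ∇ φ x - ∇ ψ x := by
  simp only [gradient]
  rw [fderiv_sub (hφ.1.differentiable (by simp)).differentiableAt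
    (hψ.1.differentiable (by simp)).differentiableAt, map_sub]

theorem IsTestFunction.integral_shell_eq [Nontrivial (EuclideanSpace ℝ (Fin N))]
    {a b R : ℝ} (ha : 0 < a) (hab : a < b) (hbR : b ≤ R)
    {φ : EuclideanSpace ℝ (Fin N) → ℝ} (hφ : IsTestFunction (ball 0 R) φ) :
    ∫ x in shell N a b, φ x = -∫ y in ball 0 R, inner ℝ (∇ φ y) y * fluxCoeff N a b ‖y‖ := by
  have hφ1 : ContDiff ℝ 1 φ := hφ.1.of_le (by simp)
  have hc : Continuous fun y => fderiv ℝ φ y y := by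
    have := hφ1.continuous_fderiv one_ne_zero
    fun_prop
  have h1 := integral_shell_integral_ray hc (R := R) (fun x hx => by
    rw [hφ.fderiv_eq_zero hx]; rfl) ha hab
  rw [finrank_euclideanSpace_fin] at h1
  rw [setIntegral_eq_integral_of_forall_compl_eq_zero (s := ball 0 R)]
  · simp only [inner_gradient_left]
    rw [← h1, ← integral_neg]
    refine setIntegral_congr_fun (measurableSet_shell a b) fun x hx => ?_
    exact neg_integral_ray_fderiv_eq hφ1 (fun x hx => hφ.eq_zero hx) ha (by linarith) hx.1.le
  · intro x hx
    rw [mem_ball_zero_iff, not_lt] at hx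
    rw [inner_gradient_left, hφ.fderiv_eq_zero hx]
    simp

/-- Absolute values are taken inside the ray integral, before the integrals are exchanged; the only
other loss is Cauchy–Schwarz for the radial derivative. -/
theorem IsTestFunction.integral_shell_abs_le [Nontrivial (EuclideanSpace ℝ (Fin N))]
    {a b R : ℝ} (ha : 0 < a) (hab : a < b) (hbR : b ≤ R)
    {φ : EuclideanSpace ℝ (Fin N) → ℝ} (hφ : IsTestFunction (ball 0 R) φ) :
    ∫ x in shell N a b, |φ x| ≤ ∫ y in ball 0 R, ‖∇ φ y‖ * (‖y‖ * fluxCoeff N a b ‖y‖) := by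
  have hφ1 : ContDiff ℝ 1 φ := hφ.1.of_le (by simp)
  have hc' := hφ.continuous_gradient
  have hc : Continuous fun y => ‖∇ φ y‖ * ‖y‖ := by fun_prop
  have hfin : finrank ℝ (EuclideanSpace ℝ (Fin N)) = N := finrank_euclideanSpace_fin
  have hgrad : ∀ x, R ≤ ‖x‖ → ∇ φ x = 0 := fun x hx => by
    rw [gradient, hφ.fderiv_eq_zero hx, map_zero]
  have h1 := integral_shell_integral_ray hc (R := R) (fun x hx => by simp [hgrad x hx]) ha hab
  rw [hfin] at h1
  rw [setIntegral_eq_integral_of_forall_compl_eq_zero (s := ball 0 R)]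
  · simp only [← mul_assoc]
    rw [← h1]
    refine setIntegral_mono_on ?_ ?_ (measurableSet_shell a b) fun x hx => ?_
    · exact (hφ.1.continuous.abs.integrable_of_hasCompactSupport
        (hφ.2.1.comp_left abs_zero)).integrableOn
    · exact (integrable_uncurry_ray hc
        (hφ.hasCompactSupport_gradient.norm.mul_right (f' := fun y => ‖y‖)) a b
        (R / a)).integral_prod_left
    · rw [neg_integral_ray_fderiv_eq hφ1 (fun x hx => hφ.eq_zero hx) ha (by linarith) hx.1.le,
        abs_neg, ← Real.norm_eq_abs]
      refine (norm_integral_le_integral_norm _).trans ?_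
      refine setIntegral_mono_on ?_ ?_ measurableSet_Ioc fun t ht => ?_
      · refine (ContinuousOn.integrableOn_Icc ?_).mono_set Ioc_subset_Icc_self
        have := hφ1.continuous_fderiv one_ne_zero
        have h2 : ∀ t ∈ Icc 1 (R / a), t ≠ 0 := fun t ht => by linarith [ht.1]
        exact ((continuousOn_inv₀.mono h2).mul (by fun_prop)).norm
      · refine (ContinuousOn.integrableOn_Icc ?_).mono_set Ioc_subset_Icc_self
        have h2 : ∀ t ∈ Icc 1 (R / a), t ≠ 0 := fun t ht => by linarith [ht.1]
        exact (continuousOn_inv₀.mono h2).mul (by fun_prop)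
      · have ht0 : 0 < t := by linarith [ht.1]
        rw [norm_mul, norm_inv, Real.norm_of_nonneg ht0.le, ← inner_gradient_left]
        gcongr
        exact norm_inner_le_norm _ _
  · intro x hx
    rw [mem_ball_zero_iff, not_lt] at hx
    simp [hgrad x hx]

/-- `u` and `G` are `L^p(Ω)` limits of test functions and of their gradients. -/
def IsTestLimit (p : ℝ) (Ω : Set (EuclideanSpace ℝ (Fin N))) (u : EuclideanSpace ℝ (Fin N) → ℝ)
    (G : EuclideanSpace ℝ (Fin N) → EuclideanSpace ℝ (Fin N)) : Prop :=
  MemLp u (ENNReal.ofReal p) (volume.restrict Ω) ∧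
    MemLp G (ENNReal.ofReal p) (volume.restrict Ω) ∧
    ∀ ε : ℝ≥0∞, 0 < ε → ∃ φ : EuclideanSpace ℝ (Fin N) → ℝ, IsTestFunction Ω φ ∧
      eLpNorm (fun x => u x - φ x) (ENNReal.ofReal p) (volume.restrict Ω) +
        eLpNorm (fun x => G x - ∇ φ x) (ENNReal.ofReal p) (volume.restrict Ω) < ε

variable {p R : ℝ} {u u' : EuclideanSpace ℝ (Fin N) → ℝ}
  {G G' : EuclideanSpace ℝ (Fin N) → EuclideanSpace ℝ (Fin N)}

theorem MemSobolevZero.isTestLimit {Ω : Set (EuclideanSpace ℝ (Fin N))}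
    (h : MemSobolevZero p Ω u G) : IsTestLimit p Ω u G :=
  ⟨h.1.1, h.1.2.1, h.2⟩

theorem IsTestFunction.memLp {Ω : Set (EuclideanSpace ℝ (Fin N))}
    {φ : EuclideanSpace ℝ (Fin N) → ℝ} (hφ : IsTestFunction Ω φ) (q : ℝ≥0∞)
    (s : Set (EuclideanSpace ℝ (Fin N))) : MemLp φ q (volume.restrict s) :=
  hφ.1.continuous.memLp_of_hasCompactSupport hφ.2.1

theorem IsTestFunction.memLp_gradient {Ω : Set (EuclideanSpace ℝ (Fin N))}
    {φ : EuclideanSpace ℝ (Fin N) → ℝ} (hφ : IsTestFunction Ω φ) (q : ℝ≥0∞)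
    (s : Set (EuclideanSpace ℝ (Fin N))) : MemLp (∇ φ) q (volume.restrict s) :=
  hφ.continuous_gradient.memLp_of_hasCompactSupport hφ.hasCompactSupport_gradient

theorem IsTestFunction.isTestLimit {Ω : Set (EuclideanSpace ℝ (Fin N))}
    {φ : EuclideanSpace ℝ (Fin N) → ℝ} (hφ : IsTestFunction Ω φ) : IsTestLimit p Ω φ (∇ φ) :=
  ⟨hφ.memLp _ _, hφ.memLp_gradient _ _, fun ε hε => ⟨φ, hφ, by simpa using hε⟩⟩

/-- Serves uniqueness: the difference of two minimizers is again a limit of test functions, and its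
gradient vanishes. -/
theorem IsTestLimit.sub {Ω : Set (EuclideanSpace ℝ (Fin N))} (hp : 1 ≤ p)
    (h : IsTestLimit p Ω u G) (h' : IsTestLimit p Ω u' G') :
    IsTestLimit p Ω (u - u') (G - G') := by
  have hp' : 1 ≤ ENNReal.ofReal p := by simpa using hp
  refine ⟨h.1.sub h'.1, h.2.1.sub h'.2.1, fun ε hε => ?_⟩
  obtain ⟨φ, hφ, hφε⟩ := h.2.2 (ε / 2) (ENNReal.half_pos hε.ne')
  obtain ⟨ψ, hψ, hψε⟩ := h'.2.2 (ε / 2) (ENNReal.half_pos hε.ne')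
  refine ⟨φ - ψ, hφ.sub hψ, ?_⟩
  have e1 : (fun x => (u - u') x - (φ - ψ) x) = (fun x => u x - φ x) - fun x => u' x - ψ x := by
    ext x; simp only [Pi.sub_apply]; ring
  have e2 : (fun x => (G - G') x - ∇ (φ - ψ) x) =
      (fun x => G x - ∇ φ x) - fun x => G' x - ∇ ψ x := by
    ext1 x
    rw [hφ.gradient_sub hψ]
    simp only [Pi.sub_apply]
    abel
  rw [e1, e2]
  calc _ ≤ (eLpNorm (fun x => u x - φ x) (ENNReal.ofReal p) (volume.restrict Ω) +
          eLpNorm (fun x => u' x - ψ x) (ENNReal.ofReal p) (volume.restrict Ω)) +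
        (eLpNorm (fun x => G x - ∇ φ x) (ENNReal.ofReal p) (volume.restrict Ω) +
          eLpNorm (fun x => G' x - ∇ ψ x) (ENNReal.ofReal p) (volume.restrict Ω)) := by
        gcongr
        · exact eLpNorm_sub_le (h.1.sub (hφ.memLp _ _)).1 (h'.1.sub (hψ.memLp _ _)).1 hp'
        · exact eLpNorm_sub_le (h.2.1.sub (hφ.memLp_gradient _ _)).1
            (h'.2.1.sub (hψ.memLp_gradient _ _)).1 hp'
    _ < ε / 2 + ε / 2 := by
        rw [add_add_add_comm]
        exact ENNReal.add_lt_add hφε hψε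
    _ = ε := ENNReal.add_halves ε

/-- Convergence in `L^1` is enough for the limits below because the flux weight is bounded on the
ball. It follows from `L^p` convergence by Hölder, the factor `C` being a power of the finite volume
of the ball. -/
theorem IsTestLimit.exists_seq (hp : 1 ≤ p) (h : IsTestLimit p (ball 0 R) u G) :
    ∃ φ : ℕ → EuclideanSpace ℝ (Fin N) → ℝ, (∀ k, IsTestFunction (ball 0 R) (φ k)) ∧
      Tendsto (fun k => eLpNorm (φ k - u) 1 (volume.restrict (ball 0 R))) atTop (𝓝 0) ∧
      Tendsto (fun k => eLpNorm (∇ (φ k) - G) 1 (volume.restrict (ball 0 R))) atTop (𝓝 0) := by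
  have hp' : 1 ≤ ENNReal.ofReal p := by simpa using hp
  have hpos : ∀ k : ℕ, (0 : ℝ≥0∞) < (k + 1 : ℝ≥0∞)⁻¹ := fun k => by
    rw [ENNReal.inv_pos]; exact ENNReal.add_ne_top.2 ⟨by simp, by simp⟩
  choose φ hφ hφε using fun k : ℕ => h.2.2 _ (hpos k)
  set μ := volume.restrict (ball (0 : EuclideanSpace ℝ (Fin N)) R) with hμ
  have hfin : IsFiniteMeasure μ := ⟨by simpa [hμ] using measure_ball_lt_top⟩
  set C := μ univ ^ (1 / (1 : ℝ≥0∞).toReal - 1 / (ENNReal.ofReal p).toReal) with hC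
  have hCtop : C ≠ ⊤ := by
    refine ENNReal.rpow_ne_top_of_nonneg ?_ (measure_ne_top _ _)
    rw [ENNReal.toReal_ofReal (by linarith)]
    have : 1 / p ≤ 1 := by rw [div_le_one (by linarith)]; exact hp
    simpa using this
  have hlim : Tendsto (fun k : ℕ => (k + 1 : ℝ≥0∞)⁻¹ * C) atTop (𝓝 0) := by
    have h1 : Tendsto (fun k : ℕ => (k + 1 : ℝ≥0∞)⁻¹) atTop (𝓝 0) := by
      have := (tendsto_add_atTop_iff_nat 1).2 ENNReal.tendsto_inv_nat_nhds_zero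
      simpa using this
    simpa using ENNReal.Tendsto.mul_const h1 (Or.inr hCtop)
  refine ⟨φ, hφ, ?_, ?_⟩
  · refine tendsto_of_tendsto_of_tendsto_of_le_of_le tendsto_const_nhds hlim
      (fun k => zero_le) fun k => ?_
    rw [eLpNorm_sub_comm]
    refine (eLpNorm_le_eLpNorm_mul_rpow_measure_univ hp' (h.1.sub ((hφ k).memLp _ _)).1).trans ?_
    gcongr
    exact (le_self_add.trans (hφε k).le)
  · refine tendsto_of_tendsto_of_tendsto_of_le_of_le tendsto_const_nhds hlim
      (fun k => zero_le) fun k => ?_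
    rw [eLpNorm_sub_comm]
    refine (eLpNorm_le_eLpNorm_mul_rpow_measure_univ hp'
      (h.2.1.sub ((hφ k).memLp_gradient _ _)).1).trans ?_
    gcongr
    exact (le_add_self.trans (hφε k).le)

theorem norm_mul_fluxCoeff_le (hN : N ≠ 0) {a b : ℝ} (ha : 0 < a)
    {y : EuclideanSpace ℝ (Fin N)} (hy : y ∈ ball 0 R) :
    |‖y‖ * fluxCoeff N a b ‖y‖| ≤ R := by
  have h0 := fluxCoeff_nonneg (n := N) (b := b) ha (norm_nonneg y)
  rw [abs_of_nonneg (by positivity)]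
  have h1 := fluxCoeff_le_one (b := b) (r := ‖y‖) hN ha
  have h2 := mem_ball_zero_iff.1 hy
  nlinarith [norm_nonneg y]

/-- Both sides are continuous under `L^1` convergence of the functions and gradients, since `|y|
m(|y|) ≤ R` on the ball. -/
theorem IsTestLimit.integral_shell_eq [Nontrivial (EuclideanSpace ℝ (Fin N))] (hp : 1 ≤ p)
    {a b : ℝ} (ha : 0 < a) (hab : a < b) (hbR : b ≤ R) (h : IsTestLimit p (ball 0 R) u G) :
    ∫ x in shell N a b, u x = -∫ y in ball 0 R, inner ℝ (G y) y * fluxCoeff N a b ‖y‖ := by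
  have hN : N ≠ 0 := by
    have := finrank_pos (R := ℝ) (M := EuclideanSpace ℝ (Fin N))
    rw [finrank_euclideanSpace_fin] at this
    exact this.ne'
  obtain ⟨φ, hφ, hu, hG⟩ := h.exists_seq hp
  set μ := volume.restrict (ball (0 : EuclideanSpace ℝ (Fin N)) R) with hμ
  have hfin : IsFiniteMeasure μ := ⟨by simpa [hμ] using measure_ball_lt_top⟩
  have hm := (measurable_fluxCoeff N a b).comp
    (measurable_norm (α := EuclideanSpace ℝ (Fin N)))
  have t1 : Tendsto (fun k => ∫ x in shell N a b, φ k x) atTop (𝓝 (∫ x in shell N a b, u x)) := by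
    have := tendsto_setIntegral_of_L1' u h.1.1
      (Eventually.of_forall fun k => (memLp_one_iff_integrable.1 ((hφ k).memLp 1 _))) hu
      (shell N a b)
    rwa [Measure.restrict_restrict_of_subset (shell_subset_ball hbR)] at this
  have t2 : Tendsto (fun k => ∫ y in ball 0 R, inner ℝ (∇ (φ k) y) y * fluxCoeff N a b ‖y‖) atTop
      (𝓝 (∫ y in ball 0 R, inner ℝ (G y) y * fluxCoeff N a b ‖y‖)) := by
    refine tendsto_integral_of_L1' _ ?_ ?_ ?_
    · exact (h.2.1.1.inner aestronglyMeasurable_id).mul hm.aestronglyMeasurable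
    · refine Eventually.of_forall fun k => ?_
      refine ((memLp_one_iff_integrable.1 ((hφ k).memLp_gradient 1 _)).norm.mul_const R).mono'
        (((hφ k).memLp_gradient 1 _).1.inner aestronglyMeasurable_id |>.mul
          hm.aestronglyMeasurable) ?_
      filter_upwards [ae_restrict_mem measurableSet_ball] with y hy
      have h1 := norm_mul_fluxCoeff_le hN (b := b) ha hy
      rw [norm_mul]
      calc ‖inner ℝ (∇ (φ k) y) y‖ * ‖fluxCoeff N a b ‖y‖‖
          ≤ (‖∇ (φ k) y‖ * ‖y‖) * ‖fluxCoeff N a b ‖y‖‖ := by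
            gcongr; exact norm_inner_le_norm _ _
        _ = ‖∇ (φ k) y‖ * |‖y‖ * fluxCoeff N a b ‖y‖| := by
            rw [abs_mul, abs_norm, Real.norm_eq_abs, mul_assoc]
        _ ≤ _ := by gcongr
    · have hlim : Tendsto (fun k => ENNReal.ofReal R * eLpNorm (∇ (φ k) - G) 1 μ) atTop (𝓝 0) := by
        simpa using ENNReal.Tendsto.const_mul hG (Or.inr (ENNReal.ofReal_ne_top (r := R)))
      refine tendsto_of_tendsto_of_tendsto_of_le_of_le tendsto_const_nhds hlim
        (fun k => zero_le) fun k => ?_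
      refine eLpNorm_le_mul_eLpNorm_of_ae_le_mul ?_ 1
      filter_upwards [ae_restrict_mem measurableSet_ball] with y hy
      have h1 := norm_mul_fluxCoeff_le hN (b := b) ha hy
      simp only [Pi.sub_apply]
      rw [← sub_mul, ← inner_sub_left, norm_mul]
      calc ‖inner ℝ (∇ (φ k) y - G y) y‖ * ‖fluxCoeff N a b ‖y‖‖
          ≤ (‖∇ (φ k) y - G y‖ * ‖y‖) * ‖fluxCoeff N a b ‖y‖‖ := by
            gcongr; exact norm_inner_le_norm _ _
        _ = |‖y‖ * fluxCoeff N a b ‖y‖| * ‖∇ (φ k) y - G y‖ := by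
            rw [abs_mul, abs_norm, Real.norm_eq_abs, mul_comm, mul_assoc, mul_comm]; ring
        _ ≤ _ := by gcongr
  refine tendsto_nhds_unique t1 ?_
  simp only [(hφ _).integral_shell_eq ha hab hbR]
  exact t2.neg

theorem IsTestLimit.integral_shell_abs_le [Nontrivial (EuclideanSpace ℝ (Fin N))] (hp : 1 ≤ p)
    {a b : ℝ} (ha : 0 < a) (hab : a < b) (hbR : b ≤ R) (h : IsTestLimit p (ball 0 R) u G) :
    ∫ x in shell N a b, |u x| ≤ ∫ y in ball 0 R, ‖G y‖ * (‖y‖ * fluxCoeff N a b ‖y‖) := by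
  have hN : N ≠ 0 := by
    have := finrank_pos (R := ℝ) (M := EuclideanSpace ℝ (Fin N))
    rw [finrank_euclideanSpace_fin] at this
    exact this.ne'
  obtain ⟨φ, hφ, hu, hG⟩ := h.exists_seq hp
  set μ := volume.restrict (ball (0 : EuclideanSpace ℝ (Fin N)) R) with hμ
  have hfin : IsFiniteMeasure μ := ⟨by simpa [hμ] using measure_ball_lt_top⟩
  have hm := (measurable_fluxCoeff N a b).comp
    (measurable_norm (α := EuclideanSpace ℝ (Fin N)))
  have hm' : AEStronglyMeasurable (fun y : EuclideanSpace ℝ (Fin N) =>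
      ‖y‖ * fluxCoeff N a b ‖y‖) μ := (measurable_norm.mul hm).aestronglyMeasurable
  have t1 : Tendsto (fun k => ∫ x in shell N a b, |φ k x|) atTop
      (𝓝 (∫ x in shell N a b, |u x|)) := by
    have := tendsto_setIntegral_of_L1' (fun x => |u x|) h.1.1.norm (F := fun k x => |φ k x|)
      (Eventually.of_forall fun k => (memLp_one_iff_integrable.1 ((hφ k).memLp 1 _)).abs)
      (tendsto_of_tendsto_of_tendsto_of_le_of_le tendsto_const_nhds hu (fun k => zero_le)
        fun k => eLpNorm_mono fun x => abs_abs_sub_abs_le (φ k x) (u x))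
      (shell N a b)
    rwa [Measure.restrict_restrict_of_subset (shell_subset_ball hbR)] at this
  have t2 : Tendsto (fun k => ∫ y in ball 0 R, ‖∇ (φ k) y‖ * (‖y‖ * fluxCoeff N a b ‖y‖)) atTop
      (𝓝 (∫ y in ball 0 R, ‖G y‖ * (‖y‖ * fluxCoeff N a b ‖y‖))) := by
    refine tendsto_integral_of_L1' _ (h.2.1.1.norm.mul hm') ?_ ?_
    · refine Eventually.of_forall fun k => ?_
      refine ((memLp_one_iff_integrable.1 ((hφ k).memLp_gradient 1 _)).norm.mul_const R).mono'
        (((hφ k).memLp_gradient 1 _).1.norm.mul hm') ?_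
      filter_upwards [ae_restrict_mem measurableSet_ball] with y hy
      have h1 := norm_mul_fluxCoeff_le hN (b := b) ha hy
      rw [norm_mul, norm_norm]
      gcongr
      exact h1
    · have hlim : Tendsto (fun k => ENNReal.ofReal R * eLpNorm (∇ (φ k) - G) 1 μ) atTop (𝓝 0) := by
        simpa using ENNReal.Tendsto.const_mul hG (Or.inr (ENNReal.ofReal_ne_top (r := R)))
      refine tendsto_of_tendsto_of_tendsto_of_le_of_le tendsto_const_nhds hlim
        (fun k => zero_le) fun k => ?_
      refine eLpNorm_le_mul_eLpNorm_of_ae_le_mul ?_ 1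
      filter_upwards [ae_restrict_mem measurableSet_ball] with y hy
      have h1 := norm_mul_fluxCoeff_le hN (b := b) ha hy
      simp only [Pi.sub_apply, Pi.mul_apply]
      rw [← sub_mul, norm_mul, mul_comm]
      gcongr
      · exact (abs_nonneg _).trans h1
      · exact h1
      · exact abs_norm_sub_norm_le _ _
  exact le_of_tendsto_of_tendsto' t1 t2 fun k => (hφ k).integral_shell_abs_le ha hab hbR

end TestLimit

/-! ### Membership in W^{1,p}_0 by dominated convergence. -/

section BoundedLimit

open Module Filter Topology

/-- Dominated convergence in `L^p` of a finite measure. -/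
theorem tendsto_eLpNorm_sub_of_bounded {α F : Type*} [MeasurableSpace α] {μ : Measure α}
    [IsFiniteMeasure μ] [NormedAddCommGroup F] {p C : ℝ} (hp : 0 < p) {f : ℕ → α → F} {g : α → F}
    (hf : ∀ k, AEStronglyMeasurable (f k) μ) (hg : AEStronglyMeasurable g μ)
    (hfC : ∀ k, ∀ᵐ x ∂μ, ‖g x - f k x‖ ≤ C)
    (hlim : ∀ᵐ x ∂μ, Tendsto (fun k => f k x) atTop (𝓝 (g x))) :
    Tendsto (fun k => eLpNorm (fun x => g x - f k x) (ENNReal.ofReal p) μ) atTop (𝓝 0) := by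
  have hp0 : ENNReal.ofReal p ≠ 0 := by simpa using hp
  have h1 : Tendsto (fun k => ∫⁻ x, ‖g x - f k x‖ₑ ^ p ∂μ) atTop (𝓝 (∫⁻ _, 0 ∂μ)) := by
    refine tendsto_lintegral_of_dominated_convergence' (fun _ => ENNReal.ofReal C ^ p)
      (fun k => (hg.sub (hf k)).enorm.pow_const p) (fun k => ?_) ?_ ?_
    · filter_upwards [hfC k] with x hx
      gcongr
      rw [← ofReal_norm]
      exact ENNReal.ofReal_le_ofReal hx
    · rw [lintegral_const]
      exact ENNReal.mul_ne_top (ENNReal.rpow_ne_top_of_nonneg hp.le ENNReal.ofReal_ne_top)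
        (measure_ne_top _ _)
    · filter_upwards [hlim] with x hx
      have h2 : Tendsto (fun k => ‖g x - f k x‖ₑ) atTop (𝓝 0) := by
        have := (tendsto_const_nhds (x := g x)).sub hx
        rw [sub_self] at this
        simpa using this.enorm
      have := (ENNReal.continuous_rpow_const (y := p)).tendsto 0 |>.comp h2
      rwa [ENNReal.zero_rpow_of_pos hp] at this
  rw [lintegral_zero] at h1
  have h2 := (ENNReal.continuous_rpow_const (y := 1 / p)).tendsto 0 |>.comp h1
  rw [ENNReal.zero_rpow_of_pos (by positivity)] at h2
  refine h2.congr fun k => ?_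
  rw [eLpNorm_eq_lintegral_rpow_enorm_toReal hp0 ENNReal.ofReal_ne_top, ENNReal.toReal_ofReal hp.le]
  rfl

variable {N : ℕ}

/-- Testing against each fixed vector `v` reduces this to scalar integration by parts. It supplies
the weak gradient of a limit of test functions. -/
theorem IsTestFunction.integral_smul_gradient {Ω : Set (EuclideanSpace ℝ (Fin N))}
    {φ ψ : EuclideanSpace ℝ (Fin N) → ℝ} (hφ : IsTestFunction Ω φ) (hψ : IsTestFunction Ω ψ) :
    ∫ x in Ω, φ x • ∇ ψ x = -∫ x in Ω, ψ x • ∇ φ x := by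
  have hintegrable : ∀ {f g : EuclideanSpace ℝ (Fin N) → ℝ}, IsTestFunction Ω f → IsTestFunction Ω g →
      Integrable fun x => f x • ∇ g x := fun hf hg =>
    (hf.1.continuous.smul hg.continuous_gradient).integrable_of_hasCompactSupport
      hf.2.1.smul_right
  have hzero : ∀ {f g : EuclideanSpace ℝ (Fin N) → ℝ}, IsTestFunction Ω f →
      ∀ x, x ∉ Ω → f x • ∇ g x = 0 := fun hf x hx => by
    rw [image_eq_zero_of_notMem_tsupport fun h => hx (hf.2.2 h), zero_smul]
  rw [setIntegral_eq_integral_of_forall_compl_eq_zero (hzero hφ),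
    setIntegral_eq_integral_of_forall_compl_eq_zero (hzero hψ)]
  refine ext_inner_left ℝ fun v => ?_
  rw [inner_neg_right, ← integral_inner (hintegrable hφ hψ), ← integral_inner (hintegrable hψ hφ)]
  have hfd : ∀ {f g : EuclideanSpace ℝ (Fin N) → ℝ}, IsTestFunction Ω f → IsTestFunction Ω g →
      Integrable fun x => f x * fderiv ℝ g x v := fun hf hg => by
    refine ((hintegrable hf hg).const_inner v).congr (Eventually.of_forall fun x => ?_)
    simp [inner_smul_right, inner_gradient_right]
  have := integral_mul_fderiv_eq_neg_fderiv_mul_of_integrable (μ := volume) (v := v)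
    (f := φ) (g := ψ) (by simpa only [mul_comm] using hfd hψ hφ) (hfd hφ hψ)
    ((hφ.1.continuous.mul hψ.1.continuous).integrable_of_hasCompactSupport hφ.2.1.mul_right)
    (fun x _ => (hφ.1.differentiable (by simp)).differentiableAt)
    (fun x _ => (hψ.1.differentiable (by simp)).differentiableAt)
  simpa [inner_smul_right, inner_gradient_right, mul_comm] using this

/-- Boundedly pointwise convergent test functions whose gradients converge in the same way have
their limit in `W^{1,p}_0`. -/
theorem memSobolevZero_of_bounded_tendsto {p R C : ℝ} (hp : 1 ≤ p)
    {φ : ℕ → EuclideanSpace ℝ (Fin N) → ℝ} (hφ : ∀ k, IsTestFunction (ball 0 R) (φ k))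
    {u : EuclideanSpace ℝ (Fin N) → ℝ} {G : EuclideanSpace ℝ (Fin N) → EuclideanSpace ℝ (Fin N)}
    (hφC : ∀ k, ∀ x ∈ ball 0 R, ‖φ k x‖ ≤ C) (hDC : ∀ k, ∀ x ∈ ball 0 R, ‖∇ (φ k) x‖ ≤ C)
    (hu : ∀ x ∈ ball 0 R, Tendsto (fun k => φ k x) atTop (𝓝 (u x)))
    (hG : ∀ x ∈ ball 0 R, Tendsto (fun k => ∇ (φ k) x) atTop (𝓝 (G x))) :
    MemSobolevZero p (ball 0 R) u G := by
  set μ := volume.restrict (ball (0 : EuclideanSpace ℝ (Fin N)) R) with hμ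
  have hfin : IsFiniteMeasure μ := ⟨by simpa [hμ] using measure_ball_lt_top⟩
  have hmem : ∀ᵐ x ∂μ, x ∈ ball (0 : EuclideanSpace ℝ (Fin N)) R :=
    ae_restrict_mem measurableSet_ball
  have hum : AEStronglyMeasurable u μ := by
    refine aestronglyMeasurable_of_tendsto_ae atTop (fun k => ((hφ k).memLp 1 _).1) ?_
    filter_upwards [hmem] with x hx using hu x hx
  have hGm : AEStronglyMeasurable G μ := by
    refine aestronglyMeasurable_of_tendsto_ae atTop (fun k => ((hφ k).memLp_gradient 1 _).1) ?_
    filter_upwards [hmem] with x hx using hG x hx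
  have huC : ∀ x ∈ ball (0 : EuclideanSpace ℝ (Fin N)) R, ‖u x‖ ≤ C := fun x hx =>
    le_of_tendsto' (hu x hx).norm fun k => hφC k x hx
  have hGC : ∀ x ∈ ball (0 : EuclideanSpace ℝ (Fin N)) R, ‖G x‖ ≤ C := fun x hx =>
    le_of_tendsto' (hG x hx).norm fun k => hDC k x hx
  have huL : ∀ q, MemLp u q μ := fun q => MemLp.of_bound hum C (hmem.mono huC)
  have hGL : ∀ q, MemLp G q μ := fun q => MemLp.of_bound hGm C (hmem.mono hGC)
  refine ⟨⟨huL _, hGL _, ?_, ?_, fun ψ hψ => ?_⟩, fun ε hε => ?_⟩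
  · exact IntegrableOn.locallyIntegrableOn (memLp_one_iff_integrable.1 (huL 1))
  · exact IntegrableOn.locallyIntegrableOn (memLp_one_iff_integrable.1 (hGL 1))
  · have t1 : Tendsto (fun k => ∫ x in ball 0 R, φ k x • ∇ ψ x) atTop
        (𝓝 (∫ x in ball 0 R, u x • ∇ ψ x)) := by
      refine tendsto_integral_of_dominated_convergence (fun x => C * ‖∇ ψ x‖)
        (fun k => ((hφ k).memLp 1 _).1.smul (hψ.memLp_gradient 1 _).1)
        ((memLp_one_iff_integrable.1 (hψ.memLp_gradient 1 _)).norm.const_mul C) (fun k => ?_) ?_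
      · filter_upwards [hmem] with x hx
        rw [norm_smul]
        gcongr
        exact hφC k x hx
      · filter_upwards [hmem] with x hx using (hu x hx).smul_const _
    have t2 : Tendsto (fun k => ∫ x in ball 0 R, ψ x • ∇ (φ k) x) atTop
        (𝓝 (∫ x in ball 0 R, ψ x • G x)) := by
      refine tendsto_integral_of_dominated_convergence (fun x => ‖ψ x‖ * C)
        (fun k => (hψ.memLp 1 _).1.smul ((hφ k).memLp_gradient 1 _).1)
        ((memLp_one_iff_integrable.1 (hψ.memLp 1 _)).norm.mul_const C) (fun k => ?_) ?_
      · filter_upwards [hmem] with x hx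
        rw [norm_smul]
        gcongr
        exact hDC k x hx
      · filter_upwards [hmem] with x hx using (hG x hx).const_smul _
    refine tendsto_nhds_unique t1 ?_
    simp only [(hφ _).integral_smul_gradient hψ]
    exact t2.neg
  · have t1 := tendsto_eLpNorm_sub_of_bounded (μ := μ) (p := p) (C := C + C) (by linarith)
      (fun k => ((hφ k).memLp 1 _).1) hum (fun k => hmem.mono fun x hx =>
        (norm_sub_le _ _).trans (add_le_add (huC x hx) (hφC k x hx))) (hmem.mono hu)
    have t2 := tendsto_eLpNorm_sub_of_bounded (μ := μ) (p := p) (C := C + C) (by linarith)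
      (fun k => ((hφ k).memLp_gradient 1 _).1) hGm (fun k => hmem.mono fun x hx =>
        (norm_sub_le _ _).trans (add_le_add (hGC x hx) (hDC k x hx))) (hmem.mono hG)
    have t3 := t1.add t2
    rw [add_zero] at t3
    obtain ⟨k, hk⟩ := (t3.eventually (gt_mem_nhds hε)).exists
    exact ⟨φ k, hφ k, hk⟩

end BoundedLimit

/-! ### Radial functions and their approximation by test functions. -/

section Radial

open Module Filter Topology

/-- A continuous function on `[a, R]`, extended by zero, is a bounded pointwise limit of smooth
functions supported in `(a, R)`. -/
theorem exists_contDiff_bounded_tendsto_indicator {a R : ℝ} (haR : a ≤ R) {h : ℝ → ℝ}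
    (hh : ContinuousOn h (Icc a R)) :
    ∃ (f : ℕ → ℝ → ℝ) (C : ℝ) (δ : ℕ → ℝ), (∀ k, 0 < δ k) ∧ (∀ k, ContDiff ℝ ∞ (f k)) ∧
      (∀ k r, r ∉ Icc (a + δ k) (R - δ k) → f k r = 0) ∧ (∀ k r, |f k r| ≤ C) ∧
      ∀ r, Tendsto (fun k => f k r) atTop (𝓝 ((Ioo a R).indicator h r)) := by
  set h' := IccExtend haR ((Icc a R).domRestrict h) with hh'
  have hc : Continuous h' := continuous_IccExtend_iff.2 (continuousOn_iff_continuous_domRestrict.1 hh)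
  obtain ⟨C, hC⟩ := isCompact_Icc.exists_bound_of_continuousOn hh
  have hC' : ∀ r, |h' r| ≤ C := fun r => hC _ (projIcc a R haR r).2
  -- A trapezoidal cutoff: it vanishes within `1 / (k + 1)` of either endpoint and outside the
  -- interval, and is 1 at distance at least `2 / (k + 1)` from both endpoints.
  set χ : ℕ → ℝ → ℝ := fun k r => max 0 (min 1 (min ((k + 1) * (r - a) - 1) ((k + 1) * (R - r) - 1)))
    with hχ
  have hχc : ∀ k, Continuous (χ k) := fun k => by simp only [hχ]; fun_prop
  have hχ0 : ∀ k r, 0 ≤ χ k r := fun k r => le_max_left _ _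
  have hχ1 : ∀ k r, χ k r ≤ 1 := fun k r => max_le zero_le_one (min_le_left _ _)
  -- The smoothing does not enlarge the support, so the margin created by the cutoff survives.
  have happrox : ∀ k : ℕ, ∃ g : ℝ → ℝ, ContDiff ℝ ∞ g ∧
      (∀ x, dist (g x) (χ k x * h' x) < 1 / ((k : ℝ) + 1)) ∧
      Function.support g ⊆ Function.support fun x => χ k x * h' x := fun k =>
    ((hχc k).mul hc).exists_contDiff_approx (⊤ : ℕ∞) continuous_const
      (fun _ => Nat.one_div_pos_of_nat)
  choose f hf hfd hfs using happrox
  have hsupp : ∀ (k : ℕ) r, r ∉ Icc (a + 1 / ((k : ℝ) + 1)) (R - 1 / ((k : ℝ) + 1)) → f k r = 0 := by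
    intro k r hr
    by_contra hne
    have h1 : χ k r ≠ 0 := left_ne_zero_of_mul (hfs k hne)
    have h2 : 0 < χ k r := lt_of_le_of_ne (hχ0 k r) (Ne.symm h1)
    simp only [hχ, lt_max_iff, lt_irrefl, false_or, lt_min_iff] at h2
    have hk : (0 : ℝ) < k + 1 := by positivity
    refine hr ⟨?_, ?_⟩
    · have : 1 / ((k : ℝ) + 1) < r - a := by rw [div_lt_iff₀ hk]; linarith [h2.2.1]
      linarith
    · have : 1 / ((k : ℝ) + 1) < R - r := by rw [div_lt_iff₀ hk]; linarith [h2.2.2]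
      linarith
  refine ⟨f, C + 1, fun k => 1 / ((k : ℝ) + 1), fun k => Nat.one_div_pos_of_nat, hf, hsupp,
    fun k r => ?_, fun r => ?_⟩
  · have h1 := hfd k r
    rw [Real.dist_eq] at h1
    have h2 : |χ k r * h' r| ≤ C := by
      rw [abs_mul, abs_of_nonneg (hχ0 k r)]
      exact (mul_le_of_le_one_left (abs_nonneg _) (hχ1 k r)).trans (hC' r)
    have h3 : 1 / ((k : ℝ) + 1) ≤ 1 := by
      rw [div_le_one (by positivity)]; linarith [(Nat.cast_nonneg k : (0 : ℝ) ≤ k)]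
    have h4 := abs_sub_abs_le_abs_sub (f k r) (χ k r * h' r)
    linarith
  · by_cases hr : r ∈ Ioo a R
    · rw [indicator_of_mem hr]
      have hev : ∀ᶠ k : ℕ in atTop, χ k r = 1 := by
        have h1 : Tendsto (fun k : ℕ => ((k : ℝ) + 1) * (r - a) - 1) atTop atTop :=
          tendsto_atTop_add_const_right _ _ ((tendsto_atTop_add_const_right _ 1
            tendsto_natCast_atTop_atTop).atTop_mul_const (sub_pos.2 hr.1))
        have h2 : Tendsto (fun k : ℕ => ((k : ℝ) + 1) * (R - r) - 1) atTop atTop :=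
          tendsto_atTop_add_const_right _ _ ((tendsto_atTop_add_const_right _ 1
            tendsto_natCast_atTop_atTop).atTop_mul_const (sub_pos.2 hr.2))
        filter_upwards [h1.eventually_ge_atTop 1, h2.eventually_ge_atTop 1] with k h3 h4
        simp only [hχ]
        rw [min_eq_left (le_min h3 h4), max_eq_right zero_le_one]
      have hlim : Tendsto (fun k : ℕ => dist (f k r) (χ k r * h' r)) atTop (𝓝 0) :=
        squeeze_zero (fun _ => dist_nonneg) (fun k => (hfd k r).le)
          tendsto_one_div_add_atTop_nhds_zero_nat
      have h5 : h' r = h r := by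
        rw [hh', IccExtend_of_mem _ _ (Ioo_subset_Icc_self hr)]; rfl
      rw [tendsto_iff_dist_tendsto_zero]
      refine hlim.congr' ?_
      filter_upwards [hev] with k hk
      rw [hk, one_mul, h5]
    · rw [indicator_of_notMem hr]
      have : ∀ k, f k r = 0 := fun k => hsupp k r fun hmem => hr
        ⟨by have := hmem.1; have h1 : 0 < 1 / ((k : ℝ) + 1) := Nat.one_div_pos_of_nat; linarith,
          by have := hmem.2; have h1 : 0 < 1 / ((k : ℝ) + 1) := Nat.one_div_pos_of_nat; linarith⟩
      simp [this]

/-- The radial function vanishing on `∂B_R` with radial derivative `-g`. -/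
noncomputable def radialPrimitive {N : ℕ} (g : ℝ → ℝ) (R : ℝ) (x : EuclideanSpace ℝ (Fin N)) : ℝ :=
  ∫ s in ‖x‖..R, g s

/-- The gradient of `radialPrimitive g R`. -/
noncomputable def radialGradient {N : ℕ} (g : ℝ → ℝ) (x : EuclideanSpace ℝ (Fin N)) :
    EuclideanSpace ℝ (Fin N) :=
  -(g ‖x‖ / ‖x‖) • x

variable {N : ℕ}

theorem norm_radialGradient {g : ℝ → ℝ} (hg : g 0 = 0) (x : EuclideanSpace ℝ (Fin N)) :
    ‖radialGradient g x‖ = |g ‖x‖| := by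
  rcases eq_or_ne x 0 with rfl | hx
  · simp [radialGradient, hg]
  · have : ‖x‖ ≠ 0 := norm_ne_zero_iff.2 hx
    rw [radialGradient, norm_smul, norm_neg, norm_div, norm_norm, Real.norm_eq_abs]
    field_simp

theorem hasGradientAt_norm {x : EuclideanSpace ℝ (Fin N)} (hx : x ≠ 0) :
    HasGradientAt (fun y : EuclideanSpace ℝ (Fin N) => ‖y‖) (‖x‖⁻¹ • x) x := by
  have hx' : ‖x‖ ≠ 0 := norm_ne_zero_iff.2 hx
  have h1 := (hasStrictFDerivAt_norm_sq x).hasFDerivAt.sqrt (by positivity)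
  simp only [Real.sqrt_sq (norm_nonneg _)] at h1
  rw [hasGradientAt_iff_hasFDerivAt]
  refine h1.congr_fderiv ?_
  ext v
  simp only [smul_apply, innerSL_apply_apply, InnerProductSpace.toDual_apply_apply,
    inner_smul_left, RCLike.conj_to_real, smul_eq_mul, nsmul_eq_mul]
  field_simp
  simp

/-- Since `g` vanishes near 0 and near `R`, the primitive is constant around the origin, where the
norm is not smooth, and zero near the boundary sphere. -/
theorem isTestFunction_radialPrimitive {g : ℝ → ℝ} (hg : ContDiff ℝ ∞ g) {a R δ : ℝ} (ha : 0 < a)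
    (hδ : 0 < δ) (hsupp : ∀ r, r ∉ Icc (a + δ) (R - δ) → g r = 0) :
    IsTestFunction (ball 0 R) (radialPrimitive (N := N) g R) ∧
      ∇ (radialPrimitive (N := N) g R) = radialGradient g := by
  have hder : ∀ r, HasDerivAt (fun r => ∫ s in r..R, g s) (-g r) r := fun r =>
    intervalIntegral.integral_hasDerivAt_left (hg.continuous.intervalIntegrable _ _)
      (hg.continuous.stronglyMeasurableAtFilter _ _) hg.continuous.continuousAt
  have hsmooth : ContDiff ℝ ∞ fun r => ∫ s in r..R, g s := by
    rw [contDiff_infty_iff_deriv]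
    refine ⟨fun r => (hder r).differentiableAt, ?_⟩
    rw [funext fun r => (hder r).deriv]
    exact hg.neg
  have hconst : ∀ x : EuclideanSpace ℝ (Fin N), ‖x‖ < a →
      radialPrimitive g R x = ∫ s in (0 : ℝ)..R, g s := by
    intro x hx
    rw [radialPrimitive, ← intervalIntegral.integral_add_adjacent_intervals
      (hg.continuous.intervalIntegrable 0 ‖x‖) (hg.continuous.intervalIntegrable ‖x‖ R)]
    rw [intervalIntegral.integral_zero_ae (a := 0), zero_add]
    refine Eventually.of_forall fun s hs => hsupp s fun hmem => ?_
    rw [uIoc_of_le (norm_nonneg x)] at hs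
    linarith [hs.2, hmem.1]
  have hev : ∀ x : EuclideanSpace ℝ (Fin N), ‖x‖ < a →
      radialPrimitive g R =ᶠ[𝓝 x] fun _ => ∫ s in (0 : ℝ)..R, g s := fun x hx => by
    filter_upwards [continuous_norm.continuousAt.eventually (gt_mem_nhds hx)] with y hy
    exact hconst y hy
  have hzero : ∀ x : EuclideanSpace ℝ (Fin N), R - δ < ‖x‖ → radialPrimitive g R x = 0 := by
    intro x hx
    refine intervalIntegral.integral_zero_ae (Eventually.of_forall fun s hs => hsupp s fun hmem => ?_)
    have h1 : min ‖x‖ R < s := hs.1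
    have h2 : R - δ < min ‖x‖ R := lt_min hx (by linarith)
    linarith [hmem.2]
  have hts : tsupport (radialPrimitive (N := N) g R) ⊆ closedBall 0 (R - δ) := by
    refine closure_minimal (fun x hx => ?_) isClosed_closedBall
    rw [mem_closedBall_zero_iff]
    by_contra! h
    exact hx (hzero x h)
  refine ⟨⟨contDiff_iff_contDiffAt.2 fun x => ?_, ?_, ?_⟩, ?_⟩
  · rcases lt_or_ge ‖x‖ a with hx | hx
    · exact contDiffAt_const.congr_of_eventuallyEq (hev x hx)
    · have hx0 : x ≠ 0 := norm_pos_iff.1 (ha.trans_le hx)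
      exact hsmooth.contDiffAt.comp x (contDiffAt_norm ℝ hx0)
  · exact (isCompact_closedBall _ _).of_isClosed_subset (isClosed_tsupport _) hts
  · exact hts.trans (closedBall_subset_ball (by linarith))
  · ext1 x
    rcases lt_or_ge ‖x‖ a with hx | hx
    · rw [(hev x hx).gradient_eq, gradient_fun_const, radialGradient,
        hsupp ‖x‖ fun hmem => by linarith [hmem.1]]
      simp
    · have hx0 : x ≠ 0 := norm_pos_iff.1 (ha.trans_le hx)
      refine HasGradientAt.gradient ?_
      have h1 := hasGradientAt_iff_hasFDerivAt.1 (hasGradientAt_norm hx0)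
      have h2 := (hder ‖x‖).comp_hasFDerivAt x h1
      rw [hasGradientAt_iff_hasFDerivAt]
      refine h2.congr_fderiv ?_
      rw [radialGradient, ← map_smul, smul_smul, ← neg_mul_eq_neg_mul, div_eq_mul_inv]

/-- Radial functions with bounded derivative approximated by radial test functions. -/
theorem exists_radial_approx {a R : ℝ} (ha : 0 < a) (haR : a < R) {h : ℝ → ℝ}
    (hh : ContinuousOn h (Icc a R)) :
    ∃ (f : ℕ → ℝ → ℝ) (C : ℝ), (∀ k, IsTestFunction (ball 0 R) (radialPrimitive (N := N) (f k) R)) ∧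
      (∀ k, ∇ (radialPrimitive (N := N) (f k) R) = radialGradient (f k)) ∧
      (∀ k, Continuous (f k)) ∧ (∀ k, ∀ r ≤ a, f k r = 0) ∧ (∀ k r, |f k r| ≤ C) ∧
      ∀ r, Tendsto (fun k => f k r) atTop (𝓝 ((Ioo a R).indicator h r)) := by
  obtain ⟨f, C, δ, hδ, hf, hsupp, hC, hlim⟩ := exists_contDiff_bounded_tendsto_indicator haR.le hh
  refine ⟨f, C, fun k => (isTestFunction_radialPrimitive (hf k) ha (hδ k) (hsupp k)).1,
    fun k => (isTestFunction_radialPrimitive (hf k) ha (hδ k) (hsupp k)).2,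
    fun k => (hf k).continuous, fun k r hr => hsupp k r fun hmem => ?_, hC, hlim⟩
  linarith [hmem.1, hδ k]

theorem tendsto_integral_of_bounded {f : ℕ → ℝ → ℝ} {C : ℝ} (hf : ∀ k, Continuous (f k))
    (hC : ∀ k r, |f k r| ≤ C) {g : ℝ → ℝ} (hlim : ∀ r, Tendsto (fun k => f k r) atTop (𝓝 (g r)))
    (s t : ℝ) : Tendsto (fun k => ∫ r in s..t, f k r) atTop (𝓝 (∫ r in s..t, g r)) :=
  intervalIntegral.tendsto_integral_filter_of_dominated_convergence (fun _ => C)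
    (Eventually.of_forall fun k => (hf k).aestronglyMeasurable)
    (Eventually.of_forall fun k => Eventually.of_forall fun r _ => hC k r)
    intervalIntegrable_const (Eventually.of_forall fun r _ => hlim r)

theorem memSobolevZero_radialPrimitive {p a R : ℝ} (hp : 1 ≤ p) (ha : 0 < a) (haR : a < R)
    {h : ℝ → ℝ} (hh : ContinuousOn h (Icc a R)) :
    MemSobolevZero p (ball 0 R) (radialPrimitive (N := N) ((Ioo a R).indicator h) R)
      (radialGradient ((Ioo a R).indicator h)) := by
  obtain ⟨f, C, htest, hgrad, hf, hzero, hC, hlim⟩ := exists_radial_approx (N := N) ha haR hh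
  have hC0 : 0 ≤ C := (abs_nonneg _).trans (hC 0 0)
  refine memSobolevZero_of_bounded_tendsto hp htest (C := max C (C * R)) ?_ ?_ ?_ ?_
  · intro k x hx
    have hx' := mem_ball_zero_iff.1 hx
    refine (intervalIntegral.norm_integral_le_of_norm_le_const fun r _ => hC k r).trans
      (le_max_of_le_right ?_)
    rw [abs_of_pos (by linarith)]
    gcongr
    linarith [norm_nonneg x]
  · intro k x hx
    rw [hgrad, norm_radialGradient (hzero k 0 ha.le)]
    exact le_max_of_le_left (hC k _)
  · exact fun x _ => tendsto_integral_of_bounded hf hC hlim _ _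
  · intro x _
    simp only [hgrad, radialGradient]
    exact ((hlim ‖x‖).div_const _).neg.smul_const x

end Radial

/-! ### The flux energy and the Poincaré inequality on the shell. -/

section FluxEnergy

open Module Filter Topology

variable {N : ℕ}

theorem volume_real_unitBall_pos (N : ℕ) :
    0 < volume.real (ball (0 : EuclideanSpace ℝ (Fin N)) 1) :=
  ENNReal.toReal_pos (measure_ball_pos _ _ one_pos).ne' measure_ball_lt_top.ne

/-- The surface area `N ω_N r^{N-1}` of the sphere of radius `r`, in terms of the volume `ω_N` of
the unit ball. -/
noncomputable def sphereArea (N : ℕ) (r : ℝ) : ℝ :=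
  N * volume.real (ball (0 : EuclideanSpace ℝ (Fin N)) 1) * r ^ (N - 1)

theorem sphereArea_pos (hN : N ≠ 0) {r : ℝ} (hr : 0 < r) : 0 < sphereArea N r := by
  have h1 : 0 < volume.real (ball (0 : EuclideanSpace ℝ (Fin N)) 1) :=
    volume_real_unitBall_pos N
  have h2 : (0 : ℝ) < N := by positivity
  unfold sphereArea
  positivity

theorem continuous_sphereArea : Continuous (sphereArea N) := by
  unfold sphereArea
  fun_prop

theorem integral_shell_radial (hN : N ≠ 0) {b R : ℝ} (hb : 0 ≤ b) (hbR : b ≤ R) (f : ℝ → ℝ) :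
    ∫ x in shell N b R, f ‖x‖ = ∫ r in b..R, sphereArea N r * f r := by
  have : Nonempty (Fin N) := ⟨⟨0, Nat.pos_of_ne_zero hN⟩⟩
  have h := integral_fun_norm_addHaar (volume : Measure (EuclideanSpace ℝ (Fin N)))
    ((Ioo b R).indicator f)
  rw [finrank_euclideanSpace_fin] at h
  rw [← integral_indicator (measurableSet_shell b R)]
  calc ∫ x, (shell N b R).indicator (fun x => f ‖x‖) x
      = ∫ x : EuclideanSpace ℝ (Fin N), (Ioo b R).indicator f ‖x‖ := by
        congr 1
    _ = ∫ y in Ioi (0 : ℝ), (Ioo b R).indicator (fun r => sphereArea N r * f r) y := by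
        rw [h, nsmul_eq_mul, smul_eq_mul, ← mul_assoc, ← integral_const_mul]
        congr 1
        ext y
        simp only [indicator, smul_eq_mul, sphereArea]
        split_ifs
        · ring
        · simp
    _ = ∫ r in b..R, sphereArea N r * f r := by
        rw [setIntegral_indicator measurableSet_Ioo, intervalIntegral.integral_of_le hbR,
          integral_Ioc_eq_integral_Ioo,
          inter_eq_right.2 (show Ioo b R ⊆ Ioi 0 from fun r hr => hb.trans_lt hr.1)]

theorem volume_real_shell (hN : N ≠ 0) {a b : ℝ} (ha : 0 ≤ a) (hab : a ≤ b) :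
    volume.real (shell N a b) =
      volume.real (ball (0 : EuclideanSpace ℝ (Fin N)) 1) * (b ^ N - a ^ N) := by
  have h := integral_shell_radial hN ha hab fun _ => 1
  rw [setIntegral_const, smul_eq_mul, mul_one] at h
  rw [h]
  simp only [sphereArea, mul_one]
  rw [intervalIntegral.integral_const_mul, integral_pow]
  have h1 : N - 1 + 1 = N := by omega
  have h2 : ((N - 1 : ℕ) : ℝ) + 1 = N := by exact_mod_cast h1
  rw [h1, h2]
  have : (N : ℝ) ≠ 0 := by exact_mod_cast hN
  field_simp

theorem volume_real_shell_pos (hN : N ≠ 0) {a b : ℝ} (ha : 0 ≤ a) (hab : a < b) :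
    0 < volume.real (shell N a b) := by
  rw [volume_real_shell hN ha hab.le]
  have : a ^ N < b ^ N := pow_lt_pow_left₀ hab ha hN
  exact mul_pos (volume_real_unitBall_pos N) (sub_pos.2 this)

theorem volume_shell_lt_top {a b : ℝ} : volume (shell N a b) < ⊤ :=
  (measure_mono (shell_subset_ball le_rfl)).trans_lt measure_ball_lt_top

theorem norm_mul_fluxCoeff_of_le (hN : N ≠ 0) {a b r : ℝ} (ha : 0 < a) (har : a ≤ r) (hrb : r ≤ b) :
    r * fluxCoeff N a b r = r / N * (1 - (a / r) ^ N) := by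
  have hr : 0 < r := ha.trans_le har
  have : (N : ℝ) ≠ 0 := by exact_mod_cast hN
  rw [fluxCoeff, min_eq_left hrb, max_eq_right har, div_pow]
  field_simp

/-- All the flux produced in the shell, of total amount `|S|`, crosses each larger sphere uniformly.
-/
theorem norm_mul_fluxCoeff_of_ge (hN : N ≠ 0) {a b r : ℝ} (ha : 0 < a) (hab : a ≤ b) (hbr : b ≤ r) :
    r * fluxCoeff N a b r = volume.real (shell N a b) / sphereArea N r := by
  have hr : 0 < r := by linarith
  have : (N : ℝ) ≠ 0 := by exact_mod_cast hN
  have hω : volume.real (ball (0 : EuclideanSpace ℝ (Fin N)) 1) ≠ 0 :=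
    (volume_real_unitBall_pos N).ne'
  rw [fluxCoeff, min_eq_right hbr, max_eq_right hab, volume_real_shell hN ha.le hab, sphereArea]
  obtain ⟨k, rfl⟩ : ∃ k, N = k + 1 := ⟨N - 1, by omega⟩
  rw [Nat.add_sub_cancel, pow_succ r k]
  field_simp

theorem continuousOn_mul_fluxCoeff (hN : N ≠ 0) {a b R : ℝ} (ha : 0 < a) :
    ContinuousOn (fun r => r * fluxCoeff N a b r) (Icc a R) := by
  refine continuousOn_id.mul (ContinuousOn.div (by fun_prop) (by fun_prop) fun r hr => ?_)
  have : 0 < r := ha.trans_le hr.1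
  have : (N : ℝ) ≠ 0 := by exact_mod_cast hN
  positivity

/-- The integral `∫_b^R (N ω_N r^{N-1})^{-1/(p-1)} dr`. -/
noncomputable def capacityIntegral (N : ℕ) (p b R : ℝ) : ℝ :=
  ∫ r in b..R, sphereArea N r ^ (-(1 / (p - 1)))

theorem continuousOn_sphereArea_rpow (hN : N ≠ 0) {b R : ℝ} (hb : 0 < b) (c : ℝ) :
    ContinuousOn (fun r => sphereArea N r ^ c) (Icc b R) :=
  continuous_sphereArea.continuousOn.rpow_const fun _ hr =>
    Or.inl (sphereArea_pos hN (hb.trans_le hr.1)).ne'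

theorem capacityIntegral_pos (hN : N ≠ 0) {p b R : ℝ} (hb : 0 < b) (hbR : b < R) :
    0 < capacityIntegral N p b R := by
  refine intervalIntegral.intervalIntegral_pos_of_pos_on ?_ (fun r hr => ?_) hbR
  · refine ContinuousOn.intervalIntegrable ?_
    rw [uIcc_of_le hbR.le]
    exact continuousOn_sphereArea_rpow hN hb _
  · exact Real.rpow_pos_of_pos (sphereArea_pos hN (hb.trans hr.1)) _

/-- The energy `∫_{B_R} (|x| m(|x|))^{p/(p-1)} dx` of the flux field. -/
noncomputable def fluxEnergy (N : ℕ) (p a b R : ℝ) : ℝ :=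
  ∫ y in ball (0 : EuclideanSpace ℝ (Fin N)) R, (‖y‖ * fluxCoeff N a b ‖y‖) ^ (p / (p - 1))

/-- In polar coordinates the part beyond `b` has integrand `A (|S| / A)^q` with `A` the area and `q
= p/(p-1)`, and `1 - q = -1/(p-1)` is the exponent in `capacityIntegral`. -/
theorem fluxEnergy_eq (hN : N ≠ 0) {p a b R : ℝ} (hp : 1 < p) (ha : 0 < a) (hab : a < b)
    (hbR : b < R) :
    fluxEnergy N p a b R =
      (∫ x in shell N a b, (‖x‖ / N * (1 - (a / ‖x‖) ^ N)) ^ (p / (p - 1))) +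
        volume.real (shell N a b) ^ (p / (p - 1)) * capacityIntegral N p b R := by
  have hq : 0 < p / (p - 1) := div_pos (by linarith) (by linarith)
  have hb : 0 < b := ha.trans hab
  set F : ℝ → ℝ := fun r => (r * fluxCoeff N a b r) ^ (p / (p - 1)) with hF
  have hFc : ContinuousOn (fun r => sphereArea N r * F r) (Icc a R) :=
    continuous_sphereArea.continuousOn.mul
      ((continuousOn_mul_fluxCoeff hN ha).rpow_const fun _ _ => Or.inr hq.le)
  have h1 : fluxEnergy N p a b R = ∫ x in shell N a R, F ‖x‖ := by
    refine (setIntegral_eq_of_subset_of_forall_sdiff_eq_zero measurableSet_ball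
      (shell_subset_ball le_rfl) fun x hx => ?_)
    have hx1 : ‖x‖ ≤ a := by
      by_contra! h
      exact hx.2 ⟨h, mem_ball_zero_iff.1 hx.1⟩
    rw [fluxCoeff_eq_zero hx1, mul_zero, Real.zero_rpow hq.ne']
  have h2 : ∫ x in shell N a b, F ‖x‖ =
      ∫ x in shell N a b, (‖x‖ / N * (1 - (a / ‖x‖) ^ N)) ^ (p / (p - 1)) := by
    refine setIntegral_congr_fun (measurableSet_shell a b) fun x hx => ?_
    simp only [hF]
    rw [norm_mul_fluxCoeff_of_le hN ha hx.1.le hx.2.le]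
  have h3 : ∫ x in shell N b R, F ‖x‖ =
      volume.real (shell N a b) ^ (p / (p - 1)) * capacityIntegral N p b R := by
    rw [integral_shell_radial hN hb.le hbR.le, capacityIntegral,
      ← intervalIntegral.integral_const_mul]
    refine intervalIntegral.integral_congr fun r hr => ?_
    rw [uIcc_of_le hbR.le] at hr
    have hr0 := sphereArea_pos hN (hb.trans_le hr.1)
    simp only [hF]
    rw [norm_mul_fluxCoeff_of_ge hN ha hab.le hr.1, Real.div_rpow measureReal_nonneg hr0.le]
    have : (-(1 / (p - 1))) = 1 - p / (p - 1) := by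
      have : p - 1 ≠ 0 := by linarith
      field_simp
      ring
    rw [this, Real.rpow_sub hr0, Real.rpow_one]
    ring
  rw [h1, ← h2, ← h3, integral_shell_radial hN ha.le (hab.trans hbR).le,
    integral_shell_radial hN ha.le hab.le, integral_shell_radial hN hb.le hbR.le,
    intervalIntegral.integral_add_adjacent_intervals]
  · refine ContinuousOn.intervalIntegrable (hFc.mono ?_)
    rw [uIcc_of_le hab.le]
    exact Icc_subset_Icc_right hbR.le
  · refine ContinuousOn.intervalIntegrable (hFc.mono ?_)
    rw [uIcc_of_le hbR.le]
    exact Icc_subset_Icc_left hab.le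

theorem shell_flux_nonneg {a b : ℝ} (ha : 0 < a) {x : EuclideanSpace ℝ (Fin N)}
    (hx : x ∈ shell N a b) : 0 ≤ ‖x‖ / N * (1 - (a / ‖x‖) ^ N) := by
  have hx0 : 0 < ‖x‖ := ha.trans hx.1
  refine mul_nonneg (by positivity) (sub_nonneg.2 (pow_le_one₀ (by positivity) ?_))
  rw [div_le_one hx0]
  exact hx.1.le

theorem fluxEnergy_pos (hN : N ≠ 0) {p a b R : ℝ} (hp : 1 < p) (ha : 0 < a) (hab : a < b)
    (hbR : b < R) : 0 < fluxEnergy N p a b R := by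
  rw [fluxEnergy_eq hN hp ha hab hbR]
  refine add_pos_of_nonneg_of_pos ?_ (mul_pos (Real.rpow_pos_of_pos
    (volume_real_shell_pos hN ha.le hab) _) (capacityIntegral_pos hN (ha.trans hab) hbR))
  exact setIntegral_nonneg (measurableSet_shell a b) fun x hx =>
    Real.rpow_nonneg (shell_flux_nonneg ha hx) _

/-- The flux profile increases on the shell, so it is at most its value `|S| / A(b)` at the outer
radius, hence at most `|S| / s`. The free parameter `s` allows both the exact area and the Hausdorff
measure. -/
theorem fluxEnergy_le (hN : N ≠ 0) {p a b R s : ℝ} (hp : 1 < p) (ha : 0 < a) (hab : a < b)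
    (hbR : b < R) (hs : 0 < s) (hsb : s ≤ sphereArea N b) :
    fluxEnergy N p a b R ≤ volume.real (shell N a b) ^ (p / (p - 1)) *
      (volume.real (shell N a b) / s ^ (p / (p - 1)) + capacityIntegral N p b R) := by
  have hq : 0 < p / (p - 1) := div_pos (by linarith) (by linarith)
  have hb : 0 < b := ha.trans hab
  have hNR : (0 : ℝ) < N := by positivity
  rw [fluxEnergy_eq hN hp ha hab hbR, mul_add]
  gcongr
  have hle : ∀ x ∈ shell N a b, ‖(‖x‖ / N * (1 - (a / ‖x‖) ^ N)) ^ (p / (p - 1))‖ ≤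
      (volume.real (shell N a b) / s) ^ (p / (p - 1)) := by
    intro x hx
    have hx0 : 0 < ‖x‖ := ha.trans hx.1
    rw [Real.norm_of_nonneg (Real.rpow_nonneg (shell_flux_nonneg ha hx) _)]
    refine Real.rpow_le_rpow (shell_flux_nonneg ha hx) ?_ hq.le
    have h1 : b / N * (1 - (a / b) ^ N) = volume.real (shell N a b) / sphereArea N b := by
      rw [← norm_mul_fluxCoeff_of_le hN ha hab.le le_rfl,
        norm_mul_fluxCoeff_of_ge hN ha hab.le le_rfl]
    calc ‖x‖ / N * (1 - (a / ‖x‖) ^ N) ≤ b / N * (1 - (a / b) ^ N) := by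
          have h2 : (a / b) ^ N ≤ (a / ‖x‖) ^ N := by
            have := hx.2.le
            gcongr
          have h3 : 0 ≤ 1 - (a / ‖x‖) ^ N := by
            refine sub_nonneg.2 (pow_le_one₀ (by positivity) ?_)
            rw [div_le_one hx0]
            exact hx.1.le
          have := hx.2.le
          gcongr
      _ = volume.real (shell N a b) / sphereArea N b := h1
      _ ≤ volume.real (shell N a b) / s := by gcongr
  have h := norm_setIntegral_le_of_norm_le_const volume_shell_lt_top hle
  refine (Real.le_norm_self _).trans (h.trans_eq ?_)
  rw [Real.div_rpow measureReal_nonneg hs.le]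
  ring

variable {p R : ℝ} {u : EuclideanSpace ℝ (Fin N) → ℝ}
  {G : EuclideanSpace ℝ (Fin N) → EuclideanSpace ℝ (Fin N)}

theorem memLp_norm_mul_fluxCoeff (hN : N ≠ 0) {a b : ℝ} (ha : 0 < a) (q : ℝ≥0∞) :
    MemLp (fun y : EuclideanSpace ℝ (Fin N) => ‖y‖ * fluxCoeff N a b ‖y‖) q
      (volume.restrict (ball 0 R)) := by
  have hfin : IsFiniteMeasure (volume.restrict (ball (0 : EuclideanSpace ℝ (Fin N)) R)) :=
    ⟨by simpa using measure_ball_lt_top⟩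
  refine MemLp.of_bound (C := R) ?_ ?_
  · exact (measurable_norm.mul
      ((measurable_fluxCoeff N a b).comp measurable_norm)).aestronglyMeasurable
  · filter_upwards [ae_restrict_mem measurableSet_ball] with y hy
    exact norm_mul_fluxCoeff_le hN ha hy

/-- The Poincaré inequality on a shell whose constant is the energy of the flux field. -/
theorem IsTestLimit.integral_shell_abs_rpow_le (hN : N ≠ 0) (hp : 1 < p) {a b : ℝ} (ha : 0 < a)
    (hab : a < b) (hbR : b ≤ R) (h : IsTestLimit p (ball 0 R) u G) :
    (∫ x in shell N a b, |u x|) ^ p ≤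
      fluxEnergy N p a b R ^ (p - 1) * ∫ x in ball 0 R, ‖G x‖ ^ p := by
  have : Nonempty (Fin N) := ⟨⟨0, Nat.pos_of_ne_zero hN⟩⟩
  have hpq : p.HolderConjugate (p / (p - 1)) := Real.HolderConjugate.conjExponent hp
  have hp0 : 0 < p := by linarith
  have h1 := h.integral_shell_abs_le hp.le ha hab hbR
  have h2 := integral_mul_le_Lp_mul_Lq_of_nonneg hpq (μ := volume.restrict (ball 0 R))
    (f := fun y => ‖G y‖) (g := fun y => ‖y‖ * fluxCoeff N a b ‖y‖)
    (Eventually.of_forall fun y => norm_nonneg _)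
    (Eventually.of_forall fun y => mul_nonneg (norm_nonneg _) (fluxCoeff_nonneg ha (norm_nonneg _)))
    h.2.1.norm (memLp_norm_mul_fluxCoeff hN ha _)
  have hA : 0 ≤ ∫ x in ball 0 R, ‖G x‖ ^ p :=
    integral_nonneg fun x => Real.rpow_nonneg (norm_nonneg _) _
  have hB : 0 ≤ fluxEnergy N p a b R := integral_nonneg fun x => Real.rpow_nonneg
    (mul_nonneg (norm_nonneg _) (fluxCoeff_nonneg ha (norm_nonneg _))) _
  have h3 : 0 ≤ ∫ x in shell N a b, |u x| := integral_nonneg fun x => abs_nonneg _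
  calc (∫ x in shell N a b, |u x|) ^ p
      ≤ ((∫ x in ball 0 R, ‖G x‖ ^ p) ^ (1 / p) *
          fluxEnergy N p a b R ^ (1 / (p / (p - 1)))) ^ p :=
        Real.rpow_le_rpow h3 (h1.trans h2) hp0.le
    _ = _ := by
        rw [Real.mul_rpow (Real.rpow_nonneg hA _) (Real.rpow_nonneg hB _), ← Real.rpow_mul hA,
          ← Real.rpow_mul hB, one_div_mul_cancel hp0.ne', Real.rpow_one, mul_comm]
        congr 2
        have : p - 1 ≠ 0 := by linarith
        field_simp

theorem IsTestLimit.integral_shell_abs_rpow_le' (hN : N ≠ 0) (hp : 1 < p) {a b s : ℝ} (ha : 0 < a)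
    (hab : a < b) (hbR : b < R) (hs : 0 < s) (hsb : s ≤ sphereArea N b)
    (h : IsTestLimit p (ball 0 R) u G) :
    (∫ x in shell N a b, |u x|) ^ p ≤ volume.real (shell N a b) ^ p *
      ((volume.real (shell N a b) / s ^ (p / (p - 1)) + capacityIntegral N p b R) ^ (p - 1) *
        ∫ x in ball 0 R, ‖G x‖ ^ p) := by
  have hA : 0 ≤ ∫ x in ball 0 R, ‖G x‖ ^ p :=
    integral_nonneg fun x => Real.rpow_nonneg (norm_nonneg _) _
  have hT := capacityIntegral_pos (p := p) hN (ha.trans hab) hbR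
  refine (h.integral_shell_abs_rpow_le hN hp ha hab hbR.le).trans ?_
  rw [← mul_assoc]
  gcongr
  refine (Real.rpow_le_rpow (fluxEnergy_pos hN hp ha hab hbR).le
    (fluxEnergy_le hN hp ha hab hbR hs hsb) (by linarith)).trans_eq ?_
  have hS : 0 ≤ volume.real (shell N a b) := measureReal_nonneg
  rw [Real.mul_rpow (Real.rpow_nonneg hS _) (by positivity), ← Real.rpow_mul hS]
  congr 2
  have : p - 1 ≠ 0 := by linarith
  field_simp

end FluxEnergy

/-! ### The capacity of concentric balls. -/

section Capacity

open Module Filter Topology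

variable {N : ℕ} {p b R : ℝ}

theorem IsTestFunction.const_mul {Ω : Set (EuclideanSpace ℝ (Fin N))}
    {φ : EuclideanSpace ℝ (Fin N) → ℝ} (hφ : IsTestFunction Ω φ) (c : ℝ) :
    IsTestFunction Ω (fun x => c * φ x) :=
  ⟨contDiff_const.mul hφ.1, hφ.2.1.mul_left, (tsupport_mul_subset_right).trans hφ.2.2⟩

theorem IsTestFunction.gradient_const_mul {Ω : Set (EuclideanSpace ℝ (Fin N))}
    {φ : EuclideanSpace ℝ (Fin N) → ℝ} (hφ : IsTestFunction Ω φ) (c : ℝ)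
    (x : EuclideanSpace ℝ (Fin N)) : ∇ (fun x => c * φ x) x = c • ∇ φ x := by
  simp only [gradient]
  rw [fderiv_const_mul (hφ.1.differentiable (by simp)).differentiableAt, map_smul]

/-- The mean of `φ` over any shell `(a, b)` is at least 1, so the Poincaré inequality bounds its
energy from below. As `a` tends to `b` the term with the volume of the shell disappears and only `T`
remains. -/
theorem le_integral_gradient_of_one_le (hN : N ≠ 0) (hp : 1 < p) (hb : 0 < b) (hbR : b < R)
    {φ : EuclideanSpace ℝ (Fin N) → ℝ} (hφ : IsTestFunction (ball 0 R) φ)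
    (h1 : ∀ x ∈ closedBall 0 b, 1 ≤ φ x) :
    capacityIntegral N p b R ^ (-(p - 1)) ≤ ∫ x in ball 0 R, ‖∇ φ x‖ ^ p := by
  set D := ∫ x in ball 0 R, ‖∇ φ x‖ ^ p
  set T := capacityIntegral N p b R
  have hT : 0 < T := capacityIntegral_pos hN hb hbR
  have hs := sphereArea_pos hN hb
  set s := sphereArea N b
  have hle : ∀ a ∈ Ioo 0 b,
      1 ≤ (volume.real (shell N a b) / s ^ (p / (p - 1)) + T) ^ (p - 1) * D := by
    intro a ha
    have hS := volume_real_shell_pos hN ha.1.le ha.2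
    have h2 := (hφ.isTestLimit (p := p)).integral_shell_abs_rpow_le' hN hp ha.1 ha.2 hbR hs le_rfl
    have h3 : volume.real (shell N a b) ≤ ∫ x in shell N a b, |φ x| := by
      have h4 : ∫ _ in shell N a b, (1 : ℝ) = volume.real (shell N a b) := by simp
      rw [← h4]
      refine setIntegral_mono_on (integrableOn_const volume_shell_lt_top.ne) ?_
        (measurableSet_shell a b) fun x hx => ?_
      · exact (memLp_one_iff_integrable.1 (hφ.memLp 1 _)).abs
      · exact (h1 x (mem_closedBall_zero_iff.2 hx.2.le)).trans (le_abs_self _)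
    have h5 := (Real.rpow_le_rpow hS.le h3 (by linarith : 0 ≤ p)).trans h2
    have h6 : 0 < volume.real (shell N a b) ^ p := Real.rpow_pos_of_pos hS _
    exact le_of_mul_le_mul_left (by rwa [mul_one]) h6
  have hlim : Tendsto (fun a => (volume.real (ball (0 : EuclideanSpace ℝ (Fin N)) 1) *
      (b ^ N - a ^ N) / s ^ (p / (p - 1)) + T) ^ (p - 1) * D) (𝓝[<] b) (𝓝 (T ^ (p - 1) * D)) := by
    have hc : Continuous fun a : ℝ => (volume.real (ball (0 : EuclideanSpace ℝ (Fin N)) 1) *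
      (b ^ N - a ^ N) / s ^ (p / (p - 1)) + T) ^ (p - 1) * D :=
      (Continuous.rpow_const (by fun_prop) fun _ => Or.inr (by linarith)).mul continuous_const
    have := hc.tendsto b
    simp only [sub_self, mul_zero, zero_div, zero_add] at this
    exact this.mono_left nhdsWithin_le_nhds
  have hfin : 1 ≤ T ^ (p - 1) * D := by
    refine ge_of_tendsto hlim ?_
    filter_upwards [Ioo_mem_nhdsLT hb] with a ha
    rw [← volume_real_shell hN ha.1.le ha.2.le]
    exact hle a ha
  rw [Real.rpow_neg hT.le, inv_le_iff_one_le_mul₀ (Real.rpow_pos_of_pos hT _), mul_comm]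
  exact hfin

/-- The capacitary potential has radial slope proportional to `A(r)^{-1/(p-1)}`. Its smooth
approximations are constant on the inner ball, equal to `c k` there, and are divided by `c k`; since
`c k → T > 0`, this is admissible for large `k`. -/
theorem exists_seq_tendsto_capacity (hN : N ≠ 0) (hp : 1 < p) (hb : 0 < b) (hbR : b < R) :
    ∃ φ : ℕ → EuclideanSpace ℝ (Fin N) → ℝ,
      (∀ᶠ k in atTop, IsTestFunction (ball 0 R) (φ k) ∧ ∀ x ∈ closedBall 0 b, 1 ≤ φ k x) ∧
      Tendsto (fun k => ∫ x in ball 0 R, ‖∇ (φ k) x‖ ^ p) atTop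
        (𝓝 (capacityIntegral N p b R ^ (-(p - 1)))) := by
  have hp0 : 0 < p := by linarith
  set h : ℝ → ℝ := fun r => sphereArea N r ^ (-(1 / (p - 1))) with hh
  obtain ⟨f, C, htest, hgrad, hf, hzero, hC, hlim⟩ :=
    exists_radial_approx (N := N) hb hbR (continuousOn_sphereArea_rpow hN hb (-(1 / (p - 1))))
  set T := capacityIntegral N p b R with hTdef
  have hT : 0 < T := capacityIntegral_pos hN hb hbR
  set c : ℕ → ℝ := fun k => ∫ r in b..R, f k r with hc
  have hcT : Tendsto c atTop (𝓝 T) := by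
    have h1 := tendsto_integral_of_bounded hf hC hlim b R
    convert h1 using 2
    rw [hTdef, capacityIntegral, intervalIntegral.integral_of_le hbR.le,
      intervalIntegral.integral_of_le hbR.le, integral_Ioc_eq_integral_Ioo,
      integral_Ioc_eq_integral_Ioo]
    refine setIntegral_congr_fun measurableSet_Ioo fun r hr => ?_
    simp only [indicator_of_mem hr]
  have hval : ∀ k, ∀ x ∈ closedBall (0 : EuclideanSpace ℝ (Fin N)) b,
      radialPrimitive (f k) R x = c k := by
    intro k x hx
    rw [mem_closedBall_zero_iff] at hx
    rw [radialPrimitive, ← intervalIntegral.integral_add_adjacent_intervals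
      ((hf k).intervalIntegrable ‖x‖ b) ((hf k).intervalIntegrable b R),
      intervalIntegral.integral_zero_ae (a := ‖x‖), zero_add]
    refine Eventually.of_forall fun r hr => hzero k r ?_
    rw [uIoc_of_le hx] at hr
    exact hr.2
  -- Because `1 - p/(p-1) = -1/(p-1)`, the unnormalized potential has energy `T`, the same number as
  -- its height; normalizing gives `T^{-p} T`.
  have henergy : ∫ x in ball (0 : EuclideanSpace ℝ (Fin N)) R, |(Ioo b R).indicator h ‖x‖| ^ p =
      T := by
    have h1 : ∫ x in ball (0 : EuclideanSpace ℝ (Fin N)) R, |(Ioo b R).indicator h ‖x‖| ^ p =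
        ∫ x in shell N b R, |(Ioo b R).indicator h ‖x‖| ^ p := by
      refine setIntegral_eq_of_subset_of_forall_sdiff_eq_zero measurableSet_ball
        (shell_subset_ball le_rfl) fun x hx => ?_
      have : ‖x‖ ∉ Ioo b R := fun hmem => hx.2 hmem
      rw [indicator_of_notMem this, abs_zero, Real.zero_rpow hp0.ne']
    have h2 : ∫ x in shell N b R, |(Ioo b R).indicator h ‖x‖| ^ p =
        ∫ x in shell N b R, h ‖x‖ ^ p := by
      refine setIntegral_congr_fun (measurableSet_shell b R) fun x hx => ?_
      have : ‖x‖ ∈ Ioo b R := hx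
      simp only [indicator_of_mem this]
      rw [abs_of_nonneg (Real.rpow_nonneg (sphereArea_pos hN (hb.trans hx.1)).le _)]
    rw [h1, h2, integral_shell_radial hN hb.le hbR.le fun r => h r ^ p]
    refine intervalIntegral.integral_congr fun r hr => ?_
    rw [uIcc_of_le hbR.le] at hr
    have hr0 := sphereArea_pos hN (hb.trans_le hr.1)
    simp only [hh]
    rw [← Real.rpow_mul hr0.le]
    nth_rewrite 1 [← Real.rpow_one (sphereArea N r)]
    rw [← Real.rpow_add hr0]
    congr 1
    have : p - 1 ≠ 0 := by linarith
    field_simp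
    ring
  have hnum : Tendsto (fun k => ∫ x in ball (0 : EuclideanSpace ℝ (Fin N)) R, |f k ‖x‖| ^ p) atTop
      (𝓝 T) := by
    rw [← henergy]
    refine tendsto_integral_of_dominated_convergence (fun _ => C ^ p) (fun k => ?_) ?_
      (fun k => ?_) ?_
    · have : Continuous fun x : EuclideanSpace ℝ (Fin N) => |f k ‖x‖| ^ p :=
        Continuous.rpow_const ((hf k).comp continuous_norm).abs fun _ => Or.inr hp0.le
      exact this.aestronglyMeasurable
    · exact integrableOn_const measure_ball_lt_top.ne
    · refine Eventually.of_forall fun x => ?_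
      rw [Real.norm_of_nonneg (Real.rpow_nonneg (abs_nonneg _) _)]
      exact Real.rpow_le_rpow (abs_nonneg _) (hC k _) hp0.le
    · exact Eventually.of_forall fun x => (hlim ‖x‖).abs.rpow_const (Or.inr hp0.le)
  refine ⟨fun k x => (c k)⁻¹ * radialPrimitive (f k) R x, ?_, ?_⟩
  · filter_upwards [hcT.eventually (lt_mem_nhds hT)] with k hk
    refine ⟨(htest k).const_mul _, fun x hx => ?_⟩
    rw [hval k x hx, inv_mul_cancel₀ hk.ne']
  · have h1 : ∀ k, ∫ x in ball 0 R, ‖∇ (fun x : EuclideanSpace ℝ (Fin N) =>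
        (c k)⁻¹ * radialPrimitive (f k) R x) x‖ ^ p =
        |(c k)⁻¹| ^ p * ∫ x in ball (0 : EuclideanSpace ℝ (Fin N)) R, |f k ‖x‖| ^ p := by
      intro k
      rw [← integral_const_mul]
      congr 1
      ext x
      rw [(htest k).gradient_const_mul, norm_smul, hgrad,
        norm_radialGradient (hzero k 0 hb.le), Real.mul_rpow (norm_nonneg _) (abs_nonneg _),
        Real.norm_eq_abs]
    simp only [h1]
    have h2 : T ^ (-(p - 1)) = |T⁻¹| ^ p * T := by
      rw [abs_of_pos (by positivity), Real.inv_rpow hT.le, ← Real.rpow_neg hT.le]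
      nth_rewrite 3 [← Real.rpow_one T]
      rw [← Real.rpow_add hT]
      congr 1
      ring
    rw [h2]
    exact ((hcT.inv₀ hT.ne').abs.rpow_const (Or.inr hp0.le)).mul hnum

/-- The capacity of a closed ball in a concentric ball. -/
theorem relCapacity_closedBall (hN : N ≠ 0) (hp : 1 < p) (hb : 0 < b) (hbR : b < R) :
    relCapacity p (closedBall (0 : EuclideanSpace ℝ (Fin N)) b) (ball 0 R) =
      capacityIntegral N p b R ^ (-(p - 1)) := by
  obtain ⟨φ, hφ, hlim⟩ := exists_seq_tendsto_capacity (N := N) hN hp hb hbR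
  refine le_antisymm (ge_of_tendsto hlim ?_) (le_csInf ?_ ?_)
  · filter_upwards [hφ] with k hk
    refine csInf_le ⟨0, ?_⟩ ⟨φ k, hk.1, hk.2, rfl⟩
    rintro _ ⟨ψ, -, -, rfl⟩
    exact integral_nonneg fun x => Real.rpow_nonneg (norm_nonneg _) _
  · obtain ⟨k, hk⟩ := hφ.exists
    exact ⟨_, φ k, hk.1, hk.2, rfl⟩
  · rintro _ ⟨ψ, hψ, hψ1, rfl⟩
    exact le_integral_gradient_of_one_le hN hp hb hbR hψ hψ1

theorem one_div_relCapacity_rpow (hN : N ≠ 0) (hp : 1 < p) (hb : 0 < b) (hbR : b < R) :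
    (1 / relCapacity p (closedBall (0 : EuclideanSpace ℝ (Fin N)) b) (ball 0 R)) ^ (1 / (p - 1)) =
      capacityIntegral N p b R := by
  have hT := capacityIntegral_pos (p := p) hN hb hbR
  have hp1 : p - 1 ≠ 0 := by linarith
  rw [relCapacity_closedBall hN hp hb hbR, Real.rpow_neg hT.le, one_div, inv_inv,
    ← Real.rpow_mul hT.le, mul_one_div_cancel hp1, Real.rpow_one]

end Capacity

/-! ### The torsion function, uniqueness and sharpness. -/

section Torsion

open Module Filter Topology

/-- A strictly convex function lies above its tangent: this is strict Bernoulli at `s / t - 1`, with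
`t = 0` treated apart. -/
theorem Real.young_rpow_lt {p s t : ℝ} (hp : 1 < p) (hs : 0 ≤ s) (ht : 0 ≤ t) (hst : s ≠ t) :
    t ^ p / p - t ^ p < s ^ p / p - t ^ (p - 1) * s := by
  have hp0 : 0 < p := by linarith
  rcases ht.eq_or_lt with rfl | ht
  · have hs' : 0 < s := lt_of_le_of_ne hs (Ne.symm hst)
    rw [Real.zero_rpow hp0.ne', Real.zero_rpow (by linarith)]
    simpa using div_pos (Real.rpow_pos_of_pos hs' p) hp0
  · have h1 := one_add_mul_self_lt_rpow_one_add (s := s / t - 1) (by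
      have : 0 ≤ s / t := by positivity
      linarith) (by
      intro h
      apply hst
      rw [sub_eq_zero, div_eq_one_iff_eq ht.ne'] at h
      exact h) hp
    rw [add_sub_cancel, Real.div_rpow hs ht.le] at h1
    have htp : 0 < t ^ p := Real.rpow_pos_of_pos ht p
    have h2 : t ^ (p - 1) = t ^ p / t := by rw [Real.rpow_sub ht, Real.rpow_one]
    rw [h2]
    have h3 := mul_lt_mul_of_pos_left h1 htp
    rw [mul_div_cancel₀ _ htp.ne'] at h3
    have h4 : t ^ p / p - t ^ p + t ^ p / t * s = (t ^ p * (1 + p * (s / t - 1))) / p := by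
      field_simp
      ring
    have h5 : (t ^ p * (1 + p * (s / t - 1))) / p < s ^ p / p := by gcongr
    linarith

theorem Real.young_rpow_le {p s t : ℝ} (hp : 1 < p) (hs : 0 ≤ s) (ht : 0 ≤ t) :
    t ^ p / p - t ^ p ≤ s ^ p / p - t ^ (p - 1) * s := by
  rcases eq_or_ne s t with rfl | hst
  · have : s ^ (p - 1) * s = s ^ p := by
      rw [← Real.rpow_add_one' hs (by linarith), sub_add_cancel]
    rw [this]
  · exact (Real.young_rpow_lt hp hs ht hst).le

/-- The pointwise minimization problem behind the torsion functional. -/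
theorem rpow_norm_sub_inner_ge {F : Type*} [NormedAddCommGroup F] [InnerProductSpace ℝ F]
    {p t : ℝ} (hp : 1 < p) (ht : 0 ≤ t) {e : F} (he : ‖e‖ ≤ 1) (ξ : F) :
    t ^ p / p - t ^ p ≤ ‖ξ‖ ^ p / p - t ^ (p - 1) * inner ℝ ξ e ∧
      (‖ξ‖ ^ p / p - t ^ (p - 1) * inner ℝ ξ e ≤ t ^ p / p - t ^ p → ξ = t • e) := by
  have hin : inner ℝ ξ e ≤ ‖ξ‖ :=
    (real_inner_le_norm ξ e).trans (mul_le_of_le_one_right (norm_nonneg _) he)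
  have htp : 0 ≤ t ^ (p - 1) := Real.rpow_nonneg ht _
  have h1 : t ^ (p - 1) * inner ℝ ξ e ≤ t ^ (p - 1) * ‖ξ‖ := by gcongr
  have h2 := Real.young_rpow_le hp (norm_nonneg ξ) ht
  refine ⟨by linarith, fun h => ?_⟩
  have hξ : ‖ξ‖ = t := by
    by_contra hne
    linarith [Real.young_rpow_lt hp (norm_nonneg ξ) ht hne]
  rcases ht.eq_or_lt with rfl | ht
  · rw [norm_eq_zero.1 hξ, zero_smul]
  · have htp' : 0 < t ^ (p - 1) := Real.rpow_pos_of_pos ht _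
    have h3 : ‖ξ‖ ≤ inner ℝ ξ e := le_of_mul_le_mul_left (by linarith) htp'
    -- With `‖ξ‖ = t ≤ ⟪ξ, e⟫` and `‖e‖ ≤ 1`, the expansion `t² - 2t⟪ξ, e⟫ + t²‖e‖²` is nonpositive.
    have h4 : ‖ξ - t • e‖ ^ 2 ≤ 0 := by
      rw [norm_sub_sq_real, inner_smul_right, norm_smul, Real.norm_of_nonneg ht.le, hξ]
      rw [hξ] at h3
      have h5 : ‖e‖ ^ 2 ≤ 1 := pow_le_one₀ (norm_nonneg _) he
      rw [mul_pow]
      nlinarith [mul_le_mul_of_nonneg_left h3 ht.le, mul_le_mul_of_nonneg_left h5 (sq_nonneg t)]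
    have h6 : ‖ξ - t • e‖ = 0 := by
      have := sq_nonneg ‖ξ - t • e‖
      exact pow_eq_zero_iff two_ne_zero |>.1 (le_antisymm h4 this)
    exact sub_eq_zero.1 (norm_eq_zero.1 h6)

variable {N : ℕ}

/-- The modulus of the gradient of the torsion function of the shell. -/
noncomputable def torsionSlope (N : ℕ) (p a b R : ℝ) : ℝ → ℝ :=
  (Ioo a R).indicator fun r => (r * fluxCoeff N a b r) ^ (1 / (p - 1))

/-- The torsion function of the shell. -/
noncomputable def torsionFunction (N : ℕ) (p a b R : ℝ) : EuclideanSpace ℝ (Fin N) → ℝ :=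
  radialPrimitive (torsionSlope N p a b R) R

/-- The gradient of the torsion function of the shell. -/
noncomputable def torsionGradient (N : ℕ) (p a b R : ℝ) :
    EuclideanSpace ℝ (Fin N) → EuclideanSpace ℝ (Fin N) :=
  radialGradient (torsionSlope N p a b R)

variable {p a b R : ℝ}

theorem torsionSlope_nonneg (ha : 0 < a) (r : ℝ) : 0 ≤ torsionSlope N p a b R r :=
  indicator_nonneg (fun _ hr => Real.rpow_nonneg (mul_nonneg (ha.trans hr.1).le
    (fluxCoeff_nonneg ha (ha.trans hr.1).le)) _) r

theorem torsionSlope_eq (hp : 1 < p) {r : ℝ} (hrR : r < R) :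
    torsionSlope N p a b R r = (r * fluxCoeff N a b r) ^ (1 / (p - 1)) := by
  unfold torsionSlope
  by_cases h : a < r
  · rw [indicator_of_mem (show r ∈ Ioo a R from ⟨h, hrR⟩)]
  · rw [indicator_of_notMem fun hr => h hr.1, fluxCoeff_eq_zero (not_lt.1 h), mul_zero,
      Real.zero_rpow (one_div_ne_zero (by linarith))]

theorem torsionSlope_rpow_sub_one (hp : 1 < p) (ha : 0 < a) {r : ℝ} (hr : 0 ≤ r) (hrR : r < R) :
    torsionSlope N p a b R r ^ (p - 1) = r * fluxCoeff N a b r := by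
  have h := mul_nonneg hr (fluxCoeff_nonneg (n := N) (b := b) ha hr)
  rw [torsionSlope_eq hp hrR, ← Real.rpow_mul h, one_div_mul_cancel (by linarith), Real.rpow_one]

theorem torsionSlope_rpow (hp : 1 < p) (ha : 0 < a) {r : ℝ} (hr : 0 ≤ r) (hrR : r < R) :
    torsionSlope N p a b R r ^ p = (r * fluxCoeff N a b r) ^ (p / (p - 1)) := by
  have h := mul_nonneg hr (fluxCoeff_nonneg (n := N) (b := b) ha hr)
  rw [torsionSlope_eq hp hrR, ← Real.rpow_mul h, one_div_mul_eq_div]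

theorem norm_torsionGradient (ha : 0 < a) (y : EuclideanSpace ℝ (Fin N)) :
    ‖torsionGradient N p a b R y‖ = torsionSlope N p a b R ‖y‖ := by
  rw [torsionGradient, norm_radialGradient, abs_of_nonneg (torsionSlope_nonneg ha _)]
  exact indicator_of_notMem (fun h => absurd h.1 (not_lt.2 ha.le)) _

theorem memSobolevZero_torsionFunction (hN : N ≠ 0) (hp : 1 < p) (ha : 0 < a) (haR : a < R) :
    MemSobolevZero p (ball 0 R) (torsionFunction N p a b R) (torsionGradient N p a b R) :=
  memSobolevZero_radialPrimitive hp.le ha haR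
    ((continuousOn_mul_fluxCoeff hN ha).rpow_const fun _ _ =>
      Or.inr (one_div_nonneg.2 (by linarith)))

theorem torsionFunction_nonneg (ha : 0 < a) {x : EuclideanSpace ℝ (Fin N)} (hx : ‖x‖ ≤ R) :
    0 ≤ torsionFunction N p a b R x :=
  intervalIntegral.integral_nonneg hx fun _ _ => torsionSlope_nonneg ha _

theorem integral_norm_torsionGradient (hp : 1 < p) (ha : 0 < a) :
    ∫ y in ball 0 R, ‖torsionGradient N p a b R y‖ ^ p = fluxEnergy N p a b R :=
  setIntegral_congr_fun measurableSet_ball fun y hy => by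
    rw [norm_torsionGradient ha, torsionSlope_rpow hp ha (norm_nonneg y) (mem_ball_zero_iff.1 hy)]

/-- The density of the torsion functional after integration by parts. -/
noncomputable def torsionDensity (p a b : ℝ) (y ξ : EuclideanSpace ℝ (Fin N)) : ℝ :=
  ‖ξ‖ ^ p / p + inner ℝ ξ y * fluxCoeff N a b ‖y‖

theorem inner_torsionGradient (hp : 1 < p) (ha : 0 < a) {y : EuclideanSpace ℝ (Fin N)}
    (hy : y ∈ ball 0 R) :
    inner ℝ (torsionGradient N p a b R y) y * fluxCoeff N a b ‖y‖ =
      -torsionSlope N p a b R ‖y‖ ^ p := by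
  have hyR := mem_ball_zero_iff.1 hy
  have h1 := torsionSlope_rpow_sub_one (N := N) (b := b) hp ha (norm_nonneg y) hyR
  have h2 : torsionSlope N p a b R ‖y‖ ^ p =
      torsionSlope N p a b R ‖y‖ ^ (p - 1) * torsionSlope N p a b R ‖y‖ := by
    rw [← Real.rpow_add_one' (torsionSlope_nonneg ha _) (by linarith), sub_add_cancel]
  rw [h2, h1, torsionGradient, radialGradient, inner_smul_left, real_inner_self_eq_norm_sq]
  rcases eq_or_ne y 0 with rfl | hy0
  · simp
  · have : ‖y‖ ≠ 0 := norm_ne_zero_iff.2 hy0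
    simp only [map_neg, RCLike.conj_to_real]
    field_simp

/-- The flux has modulus `t^(p-1)` with `t` the torsion slope, so the density is the Young
expression in the inward radial direction. The equality clause is what gives uniqueness. -/
theorem torsionDensity_ge (hp : 1 < p) (ha : 0 < a) {y : EuclideanSpace ℝ (Fin N)}
    (hy : y ∈ ball 0 R) (ξ : EuclideanSpace ℝ (Fin N)) :
    torsionDensity p a b y (torsionGradient N p a b R y) ≤ torsionDensity p a b y ξ ∧
      (torsionDensity p a b y ξ ≤ torsionDensity p a b y (torsionGradient N p a b R y) →
        ξ = torsionGradient N p a b R y) := by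
  have hyR := mem_ball_zero_iff.1 hy
  have h1 := torsionSlope_rpow_sub_one (N := N) (b := b) hp ha (norm_nonneg y) hyR
  -- At the origin this direction is 0 rather than a unit vector, hence an inequality.
  have he : ‖-(‖y‖⁻¹ • y)‖ ≤ 1 := by
    rw [norm_neg, norm_smul, norm_inv, norm_norm]
    exact inv_mul_le_one
  have h2 := rpow_norm_sub_inner_ge hp (torsionSlope_nonneg (N := N) (p := p) (b := b) (R := R)
    ha ‖y‖) he ξ
  have e1 : torsionDensity p a b y (torsionGradient N p a b R y) =
      torsionSlope N p a b R ‖y‖ ^ p / p - torsionSlope N p a b R ‖y‖ ^ p := by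
    rw [torsionDensity, inner_torsionGradient hp ha hy, norm_torsionGradient ha, sub_eq_add_neg]
  have e2 : torsionDensity p a b y ξ = ‖ξ‖ ^ p / p -
      torsionSlope N p a b R ‖y‖ ^ (p - 1) * inner ℝ ξ (-(‖y‖⁻¹ • y)) := by
    rw [torsionDensity, h1, inner_neg_right, inner_smul_right]
    rcases eq_or_ne y 0 with rfl | hy0
    · simp
    · have : ‖y‖ ≠ 0 := norm_ne_zero_iff.2 hy0
      field_simp
      ring
  have e3 : torsionGradient N p a b R y = torsionSlope N p a b R ‖y‖ • -(‖y‖⁻¹ • y) := by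
    rw [torsionGradient, radialGradient, smul_neg, smul_smul, div_eq_mul_inv, neg_smul]
  rw [e1, e2, e3]
  exact h2

variable {u : EuclideanSpace ℝ (Fin N) → ℝ}
  {G : EuclideanSpace ℝ (Fin N) → EuclideanSpace ℝ (Fin N)}

theorem integrable_norm_rpow (hp : 1 < p) (h : IsTestLimit p (ball 0 R) u G) :
    Integrable (fun y => ‖G y‖ ^ p) (volume.restrict (ball 0 R)) := by
  have := h.2.1.integrable_norm_rpow (by simpa using (by linarith : 0 < p)) ENNReal.ofReal_ne_top
  rwa [ENNReal.toReal_ofReal (by linarith)] at this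

theorem integrable_inner_mul_fluxCoeff (hN : N ≠ 0) (hp : 1 < p) (ha : 0 < a)
    (h : IsTestLimit p (ball 0 R) u G) :
    Integrable (fun y => inner ℝ (G y) y * fluxCoeff N a b ‖y‖) (volume.restrict (ball 0 R)) := by
  have hfin : IsFiniteMeasure (volume.restrict (ball (0 : EuclideanSpace ℝ (Fin N)) R)) :=
    ⟨by simpa using measure_ball_lt_top⟩
  have hG : Integrable G (volume.restrict (ball 0 R)) :=
    h.2.1.integrable (by simpa using hp.le)
  refine (hG.norm.mul_const R).mono' ((h.2.1.1.inner aestronglyMeasurable_id).mul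
    ((measurable_fluxCoeff N a b).comp measurable_norm).aestronglyMeasurable) ?_
  filter_upwards [ae_restrict_mem measurableSet_ball] with y hy
  have h1 := norm_mul_fluxCoeff_le hN (b := b) ha hy
  rw [norm_mul]
  calc ‖inner ℝ (G y) y‖ * ‖fluxCoeff N a b ‖y‖‖
      ≤ (‖G y‖ * ‖y‖) * ‖fluxCoeff N a b ‖y‖‖ := by
        gcongr; exact norm_inner_le_norm _ _
    _ = ‖G y‖ * |‖y‖ * fluxCoeff N a b ‖y‖| := by
        rw [abs_mul, abs_norm, Real.norm_eq_abs, mul_assoc]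
    _ ≤ _ := by gcongr

theorem integrable_torsionDensity (hN : N ≠ 0) (hp : 1 < p) (ha : 0 < a)
    (h : IsTestLimit p (ball 0 R) u G) :
    Integrable (fun y => torsionDensity p a b y (G y)) (volume.restrict (ball 0 R)) :=
  ((integrable_norm_rpow hp h).div_const p).add (integrable_inner_mul_fluxCoeff hN hp ha h)

theorem torsionFunctional_eq (hN : N ≠ 0) (hp : 1 < p) (ha : 0 < a) (hab : a < b) (hbR : b ≤ R)
    (h : IsTestLimit p (ball 0 R) u G) :
    torsionFunctional p a b R u G = ∫ y in ball 0 R, torsionDensity p a b y (G y) := by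
  have : Nonempty (Fin N) := ⟨⟨0, Nat.pos_of_ne_zero hN⟩⟩
  unfold torsionDensity
  rw [integral_add ((integrable_norm_rpow hp h).div_const p)
    (integrable_inner_mul_fluxCoeff hN hp ha h), torsionFunctional,
    h.integral_shell_eq hp.le ha hab hbR, sub_neg_eq_add, integral_div, one_div_mul_eq_div]

theorem isTorsionMinimizer_torsionFunction (hN : N ≠ 0) (hp : 1 < p) (ha : 0 < a) (hab : a < b)
    (hbR : b < R) :
    IsTorsionMinimizer p a b R (torsionFunction N p a b R) (torsionGradient N p a b R) := by
  have hV := memSobolevZero_torsionFunction (N := N) (b := b) hN hp ha (hab.trans hbR)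
  refine ⟨hV, fun φ Dφ hφ => ?_⟩
  rw [torsionFunctional_eq hN hp ha hab hbR.le hV.isTestLimit,
    torsionFunctional_eq hN hp ha hab hbR.le hφ.isTestLimit]
  exact setIntegral_mono_on (integrable_torsionDensity hN hp ha hV.isTestLimit)
    (integrable_torsionDensity hN hp ha hφ.isTestLimit) measurableSet_ball
    fun y hy => (torsionDensity_ge hp ha hy _).1

/-- The excess of the density over its pointwise minimum is nonnegative with integral at most 0, so
it vanishes almost everywhere and the equality case applies. -/
theorem IsTorsionMinimizer.gradient_ae_eq (hN : N ≠ 0) (hp : 1 < p) (ha : 0 < a) (hab : a < b)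
    (hbR : b < R) (h : IsTorsionMinimizer p a b R u G) :
    G =ᵐ[volume.restrict (ball 0 R)] torsionGradient N p a b R := by
  have hV := memSobolevZero_torsionFunction (N := N) (b := b) hN hp ha (hab.trans hbR)
  have h1 := h.2 _ _ hV
  rw [torsionFunctional_eq hN hp ha hab hbR.le hV.isTestLimit,
    torsionFunctional_eq hN hp ha hab hbR.le h.1.isTestLimit] at h1
  have hi1 := integrable_torsionDensity (b := b) hN hp ha hV.isTestLimit
  have hi2 := integrable_torsionDensity (b := b) hN hp ha h.1.isTestLimit
  have hnn : 0 ≤ᵐ[volume.restrict (ball 0 R)] fun y => torsionDensity p a b y (G y) -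
      torsionDensity p a b y (torsionGradient N p a b R y) := by
    filter_upwards [ae_restrict_mem measurableSet_ball] with y hy
    exact sub_nonneg.2 (torsionDensity_ge hp ha hy _).1
  have hzero : ∫ y in ball 0 R, (torsionDensity p a b y (G y) -
      torsionDensity p a b y (torsionGradient N p a b R y)) = 0 := by
    refine le_antisymm ?_ (integral_nonneg_of_ae hnn)
    rw [integral_sub hi2 hi1]
    linarith
  rw [integral_eq_zero_iff_of_nonneg_ae hnn (hi2.sub hi1)] at hzero
  filter_upwards [hzero, ae_restrict_mem measurableSet_ball] with y hy1 hy2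
  exact (torsionDensity_ge hp ha hy2 _).2 (sub_eq_zero.1 hy1).le

/-- A function in `W^{1,p}_0(B_R)` is determined by its gradient. -/
theorem IsTestLimit.ae_eq_zero (hN : N ≠ 0) (hp : 1 ≤ p) (h : IsTestLimit p (ball 0 R) u G)
    (hG : G =ᵐ[volume.restrict (ball 0 R)] 0) : u =ᵐ[volume.restrict (ball 0 R)] 0 := by
  have : Nonempty (Fin N) := ⟨⟨0, Nat.pos_of_ne_zero hN⟩⟩
  have hfin : IsFiniteMeasure (volume.restrict (ball (0 : EuclideanSpace ℝ (Fin N)) R)) :=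
    ⟨by simpa using measure_ball_lt_top⟩
  -- The flux inequality is applied with the shells `(1/(k+1), R)`, which exhaust the punctured
  -- ball.
  have hshell : ∀ k : ℕ, ∀ᵐ x ∂volume.restrict (shell N (1 / ((k : ℝ) + 1)) R), u x = 0 := by
    intro k
    rcases lt_or_ge (1 / ((k : ℝ) + 1)) R with hk | hk
    · have h1 := h.integral_shell_abs_le hp Nat.one_div_pos_of_nat hk le_rfl
      have h2 : ∫ y in ball 0 R, ‖G y‖ * (‖y‖ * fluxCoeff N (1 / ((k : ℝ) + 1)) R ‖y‖) = 0 := by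
        refine integral_eq_zero_of_ae ?_
        filter_upwards [hG] with y hy
        simp [hy]
      have h3 : ∫ x in shell N (1 / ((k : ℝ) + 1)) R, |u x| = 0 :=
        le_antisymm (h1.trans_eq h2) (integral_nonneg fun _ => abs_nonneg _)
      have hintegrable : Integrable u (volume.restrict (shell N (1 / ((k : ℝ) + 1)) R)) := by
        have h4 : IntegrableOn u (ball 0 R) := h.1.integrable (by simpa using hp)
        exact h4.mono_set (shell_subset_ball le_rfl)
      rw [integral_eq_zero_iff_of_nonneg (fun _ => abs_nonneg _) hintegrable.abs] at h3
      filter_upwards [h3] with x hx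
      exact abs_eq_zero.1 hx
    · have : shell N (1 / ((k : ℝ) + 1)) R = ∅ := by
        refine eq_empty_of_forall_notMem fun x hx => ?_
        linarith [hx.1, hx.2]
      rw [this]
      simp
  have h0 : ∀ᵐ x ∂(volume : Measure (EuclideanSpace ℝ (Fin N))), x ≠ 0 :=
    Measure.ae_ne volume 0
  have hall := ae_all_iff.2 fun k => (ae_restrict_iff' (measurableSet_shell _ _)).1 (hshell k)
  rw [EventuallyEq, ae_restrict_iff' measurableSet_ball]
  filter_upwards [h0, hall] with x hx0 hx hxR
  obtain ⟨k, hk⟩ := exists_nat_one_div_lt (norm_pos_iff.2 hx0)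
  exact hx k ⟨hk, mem_ball_zero_iff.1 hxR⟩

theorem integral_torsionFunction (hN : N ≠ 0) (hp : 1 < p) (ha : 0 < a) (hab : a < b)
    (hbR : b < R) :
    ∫ x in shell N a b, |torsionFunction N p a b R x| = fluxEnergy N p a b R := by
  have : Nonempty (Fin N) := ⟨⟨0, Nat.pos_of_ne_zero hN⟩⟩
  have hV := memSobolevZero_torsionFunction (N := N) (b := b) hN hp ha (hab.trans hbR)
  have h1 : ∫ x in shell N a b, |torsionFunction N p a b R x| =
      ∫ x in shell N a b, torsionFunction N p a b R x :=
    setIntegral_congr_fun (measurableSet_shell a b) fun x hx =>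
      abs_of_nonneg (torsionFunction_nonneg ha (hx.2.trans hbR).le)
  rw [h1, hV.isTestLimit.integral_shell_eq hp.le ha hab hbR.le, ← integral_neg,
    ← integral_norm_torsionGradient hp ha]
  refine setIntegral_congr_fun measurableSet_ball fun y hy => ?_
  rw [inner_torsionGradient hp ha hy, neg_neg, norm_torsionGradient ha]

/-- The supremum is attained by the torsion function: its integral over the shell and its energy
both equal `K`, and `K^p / K = K^(p-1)`. -/
theorem isLUB_torsion (hN : N ≠ 0) (hp : 1 < p) (ha : 0 < a) (hab : a < b) (hbR : b < R) :
    IsLUB {c : ℝ | ∃ (φ : EuclideanSpace ℝ (Fin N) → ℝ)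
        (Dφ : EuclideanSpace ℝ (Fin N) → EuclideanSpace ℝ (Fin N)),
        MemSobolevZero p (ball 0 R) φ Dφ ∧ ¬ (φ =ᵐ[volume.restrict (ball 0 R)] 0) ∧
        c = (∫ x in shell N a b, |φ x|) ^ p / ∫ x in ball 0 R, ‖Dφ x‖ ^ p}
      (fluxEnergy N p a b R ^ (p - 1)) := by
  have hK := fluxEnergy_pos hN hp ha hab hbR
  refine IsGreatest.isLUB ⟨?_, ?_⟩
  · refine ⟨torsionFunction N p a b R, torsionGradient N p a b R,
      memSobolevZero_torsionFunction hN hp ha (hab.trans hbR), fun h0 => ?_, ?_⟩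
    · have h1 := integral_torsionFunction hN hp ha hab hbR
      have h2 : ∫ x in shell N a b, |torsionFunction N p a b R x| = 0 := by
        refine integral_eq_zero_of_ae ?_
        filter_upwards [ae_restrict_of_ae_restrict_of_subset (shell_subset_ball hbR.le) h0] with x hx
        simp [hx]
      linarith
    · rw [integral_torsionFunction hN hp ha hab hbR, integral_norm_torsionGradient hp ha,
        Real.rpow_sub_one hK.ne']
  · rintro _ ⟨φ, Dφ, hφ, -, rfl⟩
    have hD : 0 ≤ ∫ x in ball 0 R, ‖Dφ x‖ ^ p :=
      integral_nonneg fun x => Real.rpow_nonneg (norm_nonneg _) _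
    -- A zero denominator needs no separate case, the quotient then being 0 by convention.
    exact div_le_of_le_mul₀ hD (Real.rpow_nonneg hK.le _)
      (hφ.isTestLimit.integral_shell_abs_rpow_le hN hp ha hab hbR.le)

end Torsion

/-! ### Assembly of the theorem. -/

theorem mainTheorem5 (N : ℕ) (hN : 2 ≤ N) (p : ℝ) (hp : 1 < p) (hpN : p ≤ N)
    (r₁ r₂ R : ℝ) (hr₁ : 0 < r₁) (hr₁₂ : r₁ < r₂) (hr₂R : r₂ < R) :
    -- existence and uniqueness of the minimizer `V`
    (∃ (V : EuclideanSpace ℝ (Fin N) → ℝ)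
        (DV : EuclideanSpace ℝ (Fin N) → EuclideanSpace ℝ (Fin N)),
      IsTorsionMinimizer p r₁ r₂ R V DV) ∧
    (∀ (V V' : EuclideanSpace ℝ (Fin N) → ℝ)
        (DV DV' : EuclideanSpace ℝ (Fin N) → EuclideanSpace ℝ (Fin N)),
      IsTorsionMinimizer p r₁ r₂ R V DV → IsTorsionMinimizer p r₁ r₂ R V' DV' →
      V =ᵐ[volume.restrict (ball 0 R)] V' ∧ DV =ᵐ[volume.restrict (ball 0 R)] DV') ∧
    -- the sharp constant and its explicit value
    (∀ (V : EuclideanSpace ℝ (Fin N) → ℝ)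
        (DV : EuclideanSpace ℝ (Fin N) → EuclideanSpace ℝ (Fin N)),
      IsTorsionMinimizer p r₁ r₂ R V DV →
      IsLUB {c : ℝ | ∃ (φ : EuclideanSpace ℝ (Fin N) → ℝ)
            (Dφ : EuclideanSpace ℝ (Fin N) → EuclideanSpace ℝ (Fin N)),
          MemSobolevZero p (ball 0 R) φ Dφ ∧ ¬ (φ =ᵐ[volume.restrict (ball 0 R)] 0) ∧
          c = (∫ x in shell N r₁ r₂, |φ x|) ^ p / ∫ x in ball 0 R, ‖Dφ x‖ ^ p}
        ((∫ x in ball 0 R, ‖DV x‖ ^ p) ^ (p - 1)) ∧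
      (∫ x in ball 0 R, ‖DV x‖ ^ p) =
        (∫ x in shell N r₁ r₂, (‖x‖ / N * (1 - (r₁ / ‖x‖) ^ N)) ^ (p / (p - 1))) +
          volume.real (shell N r₁ r₂) ^ (p / (p - 1)) *
            (1 / relCapacity p (closedBall (0 : EuclideanSpace ℝ (Fin N)) r₂) (ball 0 R)) ^
              (1 / (p - 1))) ∧
    -- the resulting Poincaré inequality
    (∀ (φ : EuclideanSpace ℝ (Fin N) → ℝ)
        (Dφ : EuclideanSpace ℝ (Fin N) → EuclideanSpace ℝ (Fin N)),
      MemSobolevZero p (ball 0 R) φ Dφ →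
      (⨍ x in shell N r₁ r₂, |φ x|) ^ p ≤
        (volume.real (shell N r₁ r₂) /
            (μHE[N - 1].real (sphere (0 : EuclideanSpace ℝ (Fin N)) r₂)) ^ (p / (p - 1)) +
          (1 / relCapacity p (closedBall (0 : EuclideanSpace ℝ (Fin N)) r₂) (ball 0 R)) ^
            (1 / (p - 1))) ^ (p - 1) *
        ∫ x in ball 0 R, ‖Dφ x‖ ^ p) := by
  have hN0 : N ≠ 0 := by omega
  have hcap := one_div_relCapacity_rpow hN0 hp (hr₁.trans hr₁₂) hr₂R
  have hgrad : ∀ (V : EuclideanSpace ℝ (Fin N) → ℝ)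
      (DV : EuclideanSpace ℝ (Fin N) → EuclideanSpace ℝ (Fin N)),
      IsTorsionMinimizer p r₁ r₂ R V DV →
      DV =ᵐ[volume.restrict (ball 0 R)] torsionGradient N p r₁ r₂ R := fun V DV h =>
    h.gradient_ae_eq hN0 hp hr₁ hr₁₂ hr₂R
  refine ⟨⟨_, _, isTorsionMinimizer_torsionFunction hN0 hp hr₁ hr₁₂ hr₂R⟩, ?_, ?_, ?_⟩
  · intro V V' DV DV' hV hV'
    have hD : DV =ᵐ[volume.restrict (ball 0 R)] DV' := (hgrad V DV hV).trans (hgrad V' DV' hV').symm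
    refine ⟨?_, hD⟩
    have h0 := (hV.1.isTestLimit.sub hp.le hV'.1.isTestLimit).ae_eq_zero hN0 hp.le (by
      filter_upwards [hD] with x hx
      simp [hx])
    filter_upwards [h0] with x hx
    exact sub_eq_zero.1 hx
  · intro V DV hV
    have hintegrable : ∫ x in ball 0 R, ‖DV x‖ ^ p = fluxEnergy N p r₁ r₂ R := by
      rw [← integral_norm_torsionGradient hp hr₁]
      refine integral_congr_ae ?_
      filter_upwards [hgrad V DV hV] with x hx
      rw [hx]
    rw [hintegrable, hcap]
    exact ⟨isLUB_torsion hN0 hp hr₁ hr₁₂ hr₂R, fluxEnergy_eq hN0 hp hr₁ hr₁₂ hr₂R⟩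
  · intro φ Dφ hφ
    have : Nonempty (Fin N) := ⟨⟨0, by omega⟩⟩
    have hH := euclideanHausdorffMeasure_sphere_mem_Ioc (E := EuclideanSpace ℝ (Fin N))
      (hr₁.trans hr₁₂)
    rw [finrank_euclideanSpace_fin] at hH
    have hS := volume_real_shell_pos hN0 hr₁.le hr₁₂
    -- Here `s` is the Hausdorff measure of the outer sphere; `hH` provides its positivity and the
    -- comparison with `sphereArea`.
    have h := hφ.isTestLimit.integral_shell_abs_rpow_le' hN0 hp hr₁ hr₁₂ hr₂R hH.1 hH.2
    rw [hcap, setAverage_eq, smul_eq_mul, Real.mul_rpow (by positivity)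
      (integral_nonneg fun x => abs_nonneg _), Real.inv_rpow hS.le,
      inv_mul_le_iff₀ (Real.rpow_pos_of_pos hS _)]
    exact h
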